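/- Let $(\Omega,dx)$ be a finite measure space, $|\Omega|<\infty$ (for instance a metric measure space of finite measure). Let $1\le p<\infty$ with conjugate exponent $p'$, let $1<\rho<\infty$, and let $h\in L^\infty(\Omega)$. Let $J:\Omega\times\Omega\to\mathbb{R}$ be measurable with $J(x,y)=J(y,x)$ and $J(x,y)\ge 0$ for a.e. $(x,y)$, and $J\in L^\infty(\Omega,L^1(\Omega))\cap L^p(\Omega,L^{p'}(\Omega))$, i.e. the norms $\big\|x\mapsto\|J(x,\cdot)\|_{L^1(\Omega)}\big\|_{L^\infty(\Omega)}$ and $\big\|x\mapsto\|J(x,\cdot)\|_{L^{p'}(\Omega)}\big\|_{L^p(\Omega)}$ are finite. Put $Ku(x)=\int_\Omega J(x,y)u(y)\,dy$ and $L=K-hI$, a bounded operator on $L^p(\Omega)$. Let $f:\Omega\times\mathbb{R}\to\mathbb{R}$ be such that $f(\cdot,s)$ is measurable for every $s$; $f(x,s)$ is locally Lipschitz in $s$, uniformly in $x$ (for every $R$ there is $M_R$ such that for a.e. $x$ the function $f(x,\cdot)$ is $M_R$-Lipschitz on $[-R,R]$); $f(\cdot,0)\in L^\infty(\Omega)$;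 and, for some $\beta\in L^\infty(\Omega)$ and some constant $C$, for a.e. $x\in\Omega$ and a.e. $s\in\mathbb{R}$, $$\frac{\partial f}{\partial s}(x,s)\le\beta(x),\qquad \Big|\frac{\partial f}{\partial s}(x,s)\Big|\le C\big(1+|s|^{\rho-1}\big).$$ Then for every $u_0\in L^{p\rho}(\Omega)$ there is a global solution $u:[0,\infty)\to L^{p\rho}(\Omega)$ of $$u_t(x,t)=Lu(x,t)+f(x,u(x,t)),\quad t>0,\qquad u(x,0)=u_0(x),$$ such that for every $T>0$: $u\in C([0,T],L^{p\rho}(\Omega))\cap C^1([0,T],L^p(\Omega))$; $u$ is given by the variation of constants formula $$u(\cdot,t)=e^{Lt}u_0+\int_0^t e^{L(t-s)}f(\cdot,u(\cdot,s))\,ds,\qquad t\in[0,T],$$ understood in $L^p(\Omega)$, with $s\mapsto f(\cdot,u(\cdot,s))$ integrable from $[0,T]$ into $L^p(\Omega)$; and $u$ is a strong solution in $L^p(\Omega)$, that is, $u(0)=u_0$ and $u_t=Lu+f(\cdot,u)$ holds in $L^p(\Omega)$ for every $t\in[0,T]$ (with one-sided derivatives at the ends). This solution is unique: for every $T>0$,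 any $v\in C([0,T],L^{p\rho}(\Omega))$ that satisfies the variation of constants formula on $[0,T]$, and any $v\in C([0,T],L^{p\rho}(\Omega))\cap C^1([0,T],L^p(\Omega))$ that is a strong solution in $L^p(\Omega)$ on $[0,T]$ with $v(0)=u_0$, coincides with $u$ on $[0,T]$. -/

import Mathlib

open MeasureTheory Set Filter Topology
open scoped ENNReal NNReal

namespace NonlocalDiffusion

noncomputable section

/-- `J ∈ L^a(Ω, L^b(Ω))`: the kernel `J` is (a.e. strongly) measurable on the product space and
its mixed norm `‖ x ↦ ‖J(x, ·)‖_{L^b(Ω)} ‖_{L^a(Ω)}` is finite. -/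
def KernelMemLp {Ω : Type*} [MeasurableSpace Ω] (J : Ω → Ω → ℝ) (a b : ℝ≥0∞) (μ : Measure Ω) :
    Prop :=
  AEStronglyMeasurable (Function.uncurry J) (μ.prod μ) ∧
    eLpNorm (fun x => eLpNorm (J x) b μ) a μ < ⊤

section multiplication

variable {Ω : Type*} [MeasurableSpace Ω] {μ : Measure Ω} {p : ℝ≥0∞} [Fact (1 ≤ p)]

/-- The multiplication operator `v ↦ h v` on `L^p(Ω)`, for `h ∈ L^∞(Ω)`. -/
def mulOp {h : Ω → ℝ} (hh : MemLp h ⊤ μ) : Lp ℝ p μ →L[ℝ] Lp ℝ p μ :=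
  (ContinuousLinearMap.mul ℝ ℝ).holderL μ ⊤ p p (hh.toLp h)

lemma coeFn_mulOp {h : Ω → ℝ} (hh : MemLp h ⊤ μ) (v : Lp ℝ p μ) :
    mulOp hh v =ᵐ[μ] fun x => h x * v x := by
  have h1 := (ContinuousLinearMap.mul ℝ ℝ).coeFn_holder (r := p) (hh.toLp h) v
  filter_upwards [h1, hh.coeFn_toLp] with x hx hx2
  exact hx.trans (by rw [hx2]; rfl)

end multiplication

section operators

variable {Ω : Type*} [MeasurableSpace Ω] {μ : Measure Ω} [SFinite μ]
  {p : ℝ≥0∞} [Fact (1 ≤ p)] {J : Ω → Ω → ℝ}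

/-- For almost every `x`, the function `y ↦ J(x, y) v(y)` is integrable when `v ∈ L^p(Ω)`. -/
lemma KernelMemLp.ae_integrable (hJ : KernelMemLp J p p.conjExponent μ) {v : Ω → ℝ}
    (hv : MemLp v p μ) : ∀ᵐ x ∂μ, Integrable (fun y => J x y * v y) μ := by
  rcases eq_or_ne (eLpNorm v p μ) 0 with h0 | h0
  · have hp0 : p ≠ 0 := (lt_of_lt_of_le zero_lt_one (Fact.out : 1 ≤ p)).ne'
    have hv0 : v =ᵐ[μ] 0 := (eLpNorm_eq_zero_iff hv.1 hp0).1 h0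
    refine Eventually.of_forall fun x => ?_
    refine (integrable_zero Ω ℝ μ).congr ?_
    filter_upwards [hv0] with y hy
    simp [hy]
  · have hm : ∀ᵐ x ∂μ, AEStronglyMeasurable (J x) μ := hJ.1.prodMk_left
    have hI : AEStronglyMeasurable (fun z : Ω × Ω => J z.1 z.2 * v z.2) (μ.prod μ) :=
      hJ.1.mul hv.1.comp_snd
    have hmeas : AEMeasurable (fun x => ∫⁻ y, ‖J x y * v y‖ₑ ∂μ) μ :=
      hI.enorm.lintegral_prod_right'
    have hle : ∀ᵐ x ∂μ, ‖∫⁻ y, ‖J x y * v y‖ₑ ∂μ‖ₑ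
        ≤ ((eLpNorm v p μ).toNNReal : ℝ≥0∞) * ‖eLpNorm (J x) p.conjExponent μ‖ₑ := by
      filter_upwards [hm] with x hx
      rw [ENNReal.coe_toNNReal hv.2.ne, enorm_eq_self, enorm_eq_self, mul_comm]
      have := eLpNorm_smul_le_mul_eLpNorm (p := p.conjExponent) (q := p) (r := 1) hv.1 hx
      rwa [eLpNorm_one_eq_lintegral_enorm] at this
    have hfin : eLpNorm (fun x => ∫⁻ y, ‖J x y * v y‖ₑ ∂μ) p μ < ⊤ :=
      (eLpNorm_le_mul_eLpNorm_of_ae_le_mul' hle p).trans_lt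
        (ENNReal.mul_lt_top ENNReal.coe_lt_top hJ.2)
    have hae : ∀ᵐ x ∂μ, ∫⁻ y, ‖J x y * v y‖ₑ ∂μ < ⊤ := by
      rcases eq_or_ne p ⊤ with hp | hp
      · subst hp
        rw [eLpNorm_exponent_top] at hfin
        filter_upwards [ae_lt_of_essSup_lt hfin] with x hx
        simpa using hx
      · have hp0 : p ≠ 0 := (lt_of_lt_of_le zero_lt_one (Fact.out : 1 ≤ p)).ne'
        have h1 := lintegral_rpow_enorm_lt_top_of_eLpNorm_lt_top hp0 hp hfin
        have h2 := ae_lt_top' (hmeas.enorm.pow_const _) h1.ne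
        filter_upwards [h2] with x hx
        have hpos : 0 < p.toReal := ENNReal.toReal_pos hp0 hp
        by_contra hcon
        rw [not_lt, top_le_iff] at hcon
        rw [enorm_eq_self, hcon, ENNReal.top_rpow_of_pos hpos] at hx
        exact lt_irrefl _ hx
    filter_upwards [hm, hae] with x hx hx2
    exact ⟨hx.mul hv.1, hx2⟩

/-- Hölder's inequality for the nonlocal operator. -/
lemma KernelMemLp.ae_enorm_le (hJ : KernelMemLp J p p.conjExponent μ) {v : Ω → ℝ}
    (hv : MemLp v p μ) :
    ∀ᵐ x ∂μ, ‖∫ y, J x y * v y ∂μ‖ₑ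
      ≤ ((eLpNorm v p μ).toNNReal : ℝ≥0∞) * ‖eLpNorm (J x) p.conjExponent μ‖ₑ := by
  have hm : ∀ᵐ x ∂μ, AEStronglyMeasurable (J x) μ := hJ.1.prodMk_left
  filter_upwards [hm] with x hx
  rw [ENNReal.coe_toNNReal hv.2.ne, enorm_eq_self, mul_comm]
  refine (enorm_integral_le_lintegral_enorm _).trans ?_
  have := eLpNorm_smul_le_mul_eLpNorm (p := p.conjExponent) (q := p) (r := 1) hv.1 hx
  rwa [eLpNorm_one_eq_lintegral_enorm] at this

lemma KernelMemLp.eLpNorm_le (hJ : KernelMemLp J p p.conjExponent μ) {v : Ω → ℝ}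
    (hv : MemLp v p μ) :
    eLpNorm (fun x => ∫ y, J x y * v y ∂μ) p μ
      ≤ eLpNorm (fun x => eLpNorm (J x) p.conjExponent μ) p μ * eLpNorm v p μ := by
  have := eLpNorm_le_mul_eLpNorm_of_ae_le_mul' (hJ.ae_enorm_le hv) p
  rwa [ENNReal.coe_toNNReal hv.2.ne, mul_comm] at this

lemma KernelMemLp.memLp (hJ : KernelMemLp J p p.conjExponent μ) {v : Ω → ℝ}
    (hv : MemLp v p μ) : MemLp (fun x => ∫ y, J x y * v y ∂μ) p μ := by
  have hI : AEStronglyMeasurable (fun z : Ω × Ω => J z.1 z.2 * v z.2) (μ.prod μ) :=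
    hJ.1.mul hv.1.comp_snd
  exact ⟨hI.integral_prod_right', (hJ.eLpNorm_le hv).trans_lt (ENNReal.mul_lt_top hJ.2 hv.2)⟩

/-- The nonlocal operator `K v (x) = ∫ J(x, y) v(y) dy` as a bounded operator on `L^p(Ω)`. -/
def nonlocalK (hJ : KernelMemLp J p p.conjExponent μ) : Lp ℝ p μ →L[ℝ] Lp ℝ p μ :=
  LinearMap.mkContinuous
    { toFun := fun v => (hJ.memLp (Lp.memLp v)).toLp
      map_add' := fun v w => by
        rw [← MemLp.toLp_add]
        apply MemLp.toLp_congr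
        filter_upwards [hJ.ae_integrable (Lp.memLp v), hJ.ae_integrable (Lp.memLp w)] with x hv hw
        simp only [Pi.add_apply]
        rw [← integral_add hv hw]
        apply integral_congr_ae
        filter_upwards [Lp.coeFn_add v w] with y hy
        rw [hy, Pi.add_apply, mul_add]
      map_smul' := fun c v => by
        rw [RingHom.id_apply, ← MemLp.toLp_const_smul]
        apply MemLp.toLp_congr
        refine Eventually.of_forall fun x => ?_
        simp only [Pi.smul_apply, smul_eq_mul]
        rw [← integral_const_mul]
        apply integral_congr_ae
        filter_upwards [Lp.coeFn_smul c v] with y hy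
        rw [hy, Pi.smul_apply, smul_eq_mul]
        ring }
    (eLpNorm (fun x => eLpNorm (J x) p.conjExponent μ) p μ).toReal
    (fun v => by
      simp only [LinearMap.coe_mk, AddHom.coe_mk]
      rw [Lp.norm_toLp, Lp.norm_def, ← ENNReal.toReal_mul]
      exact ENNReal.toReal_mono (ENNReal.mul_lt_top hJ.2 (Lp.memLp v).2).ne
        (hJ.eLpNorm_le (Lp.memLp v)))

lemma coeFn_nonlocalK (hJ : KernelMemLp J p p.conjExponent μ) (v : Lp ℝ p μ) :
    nonlocalK hJ v =ᵐ[μ] fun x => ∫ y, J x y * v y ∂μ :=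
  MemLp.coeFn_toLp (hJ.memLp (Lp.memLp v))

/-- The bounded operator `L = K - h I` on `L^p(Ω)`. -/
def linOp (hJ : KernelMemLp J p p.conjExponent μ) {h : Ω → ℝ} (hh : MemLp h ⊤ μ) :
    Lp ℝ p μ →L[ℝ] Lp ℝ p μ :=
  nonlocalK hJ - mulOp hh

/-- `L v (x) = ∫ J(x, y) v(y) dy - h(x) v(x)`. -/
lemma coeFn_linOp (hJ : KernelMemLp J p p.conjExponent μ) {h : Ω → ℝ} (hh : MemLp h ⊤ μ)
    (v : Lp ℝ p μ) :
    linOp hJ hh v =ᵐ[μ] fun x => (∫ y, J x y * v y ∂μ) - h x * v x := by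
  have h1 : linOp hJ hh v = nonlocalK hJ v - mulOp hh v := rfl
  rw [h1]
  filter_upwards [Lp.coeFn_sub (nonlocalK hJ v) (mulOp hh v), coeFn_nonlocalK hJ v,
    coeFn_mulOp hh v] with x a b c
  rw [a, Pi.sub_apply, b, c]

end operators

section exponents

variable {p : ℝ≥0∞} {ρ : ℝ}

lemma le_mul_ofReal (p : ℝ≥0∞) (ρ : ℝ) [hρ : Fact (1 < ρ)] : p ≤ p * ENNReal.ofReal ρ := by
  conv_lhs => rw [← mul_one p]
  gcongr
  rw [← ENNReal.ofReal_one]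
  exact ENNReal.ofReal_le_ofReal hρ.out.le

/-- The exponent `p ρ` is at least `1`, so `L^{pρ}(Ω)` is a normed space. -/
instance fact_one_le_mul_ofReal [hp : Fact (1 ≤ p)] [Fact (1 < ρ)] :
    Fact (1 ≤ p * ENNReal.ofReal ρ) :=
  ⟨hp.out.trans (le_mul_ofReal p ρ)⟩

end exponents

section solutions

variable {Ω : Type*} [MeasurableSpace Ω] {μ : Measure Ω} [IsFiniteMeasure μ]
  {p : ℝ≥0∞} {ρ : ℝ} [Fact (1 < ρ)]

/-- The inclusion `L^{pρ}(Ω) ⊆ L^p(Ω)` on a finite measure space. It does not change the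
underlying class of functions. -/
def incl (v : Lp ℝ (p * ENNReal.ofReal ρ) μ) : Lp ℝ p μ :=
  AddSubgroup.inclusion (Lp.antitone (le_mul_ofReal p ρ)) v

lemma coeFn_incl (v : Lp ℝ (p * ENNReal.ofReal ρ) μ) : (incl v : Ω → ℝ) = (v : Ω → ℝ) := rfl

variable [Fact (1 ≤ p)] {J : Ω → Ω → ℝ} {h : Ω → ℝ}

/-- `u ∈ C([0,T], L^{pρ}(Ω))` is given by the variation of constants formula
`u(t) = e^{Lt} u₀ + ∫₀ᵗ e^{L(t-s)} f(·, u(·, s)) ds` on `[0,T]`, an identity in `L^p(Ω)`. Here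
`g(s)` is the class of `f(·, u(·, s))`, which is required to lie in `L^p(Ω)` for every `s` and to
be Bochner integrable on `[0,T]` as a function of `s`. -/
def IsMildSolution (hJ : KernelMemLp J p p.conjExponent μ) (hh : MemLp h ⊤ μ)
    (f : Ω → ℝ → ℝ) (u₀ : Lp ℝ (p * ENNReal.ofReal ρ) μ) (T : ℝ)
    (u : ℝ → Lp ℝ (p * ENNReal.ofReal ρ) μ) : Prop :=
  ContinuousOn u (Icc 0 T) ∧
    ∃ g : ℝ → Lp ℝ p μ, IntegrableOn g (Icc 0 T) ∧
      (∀ t ∈ Icc 0 T, g t =ᵐ[μ] fun x => f x (u t x)) ∧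
      ∀ t ∈ Icc 0 T, incl (u t) = NormedSpace.exp (t • linOp hJ hh) (incl u₀) +
        ∫ s in (0 : ℝ)..t, NormedSpace.exp ((t - s) • linOp hJ hh) (g s)

/-- `u ∈ C([0,T], L^{pρ}(Ω)) ∩ C¹([0,T], L^p(Ω))` is a strong solution in `L^p(Ω)` on `[0,T]` of
`u_t(x,t) = ∫ J(x,y) u(y,t) dy - h(x) u(x,t) + f(x, u(x,t))`, `u(x,0) = u₀(x)`. The function `u'`
is the time derivative of `u` as a map into `L^p(Ω)`, one-sided at the ends of `[0,T]`. -/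
def IsStrongSolution (J : Ω → Ω → ℝ) (h : Ω → ℝ) (f : Ω → ℝ → ℝ)
    (u₀ : Lp ℝ (p * ENNReal.ofReal ρ) μ) (T : ℝ)
    (u : ℝ → Lp ℝ (p * ENNReal.ofReal ρ) μ) : Prop :=
  ContinuousOn u (Icc 0 T) ∧ u 0 = u₀ ∧
    ∃ u' : ℝ → Lp ℝ p μ, ContinuousOn u' (Icc 0 T) ∧
      (∀ t ∈ Icc 0 T, HasDerivWithinAt (fun s => (incl (u s) : Lp ℝ p μ)) (u' t) (Icc 0 T) t) ∧
      ∀ t ∈ Icc 0 T, u' t =ᵐ[μ] fun x =>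
        (∫ y, J x y * u t y ∂μ) - h x * u t x + f x (u t x)

end solutions

end

end NonlocalDiffusion

open NonlocalDiffusion

/-! The growth of `f` prevents the Nemytskii operator from acting on `L^{pρ}` as a locally Lipschitz
map, so Picard iteration is not available there. What replaces it is dissipativity: the bound on
`∂f/∂s` from above gives `(f(x,s) - f(x,r))(s - r) ≤ b (s - r)²`, and multiplication by `-h`
satisfies a similar bound. Such terms enlarge the norm at most at an exponential rate, in every
`L^r` at once, whatever the size of the Lipschitz constants. Together with a bound on `K` this is a
Grönwall estimate (`norm_le_of_velocity_decomposition`), and it is used three times.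

In `L^∞`, bounded data are handled by truncation: the truncated field is bounded and globally
Lipschitz, and the estimate, whose constants do not see the truncation level, shows that the
truncation is never active (`exists_bounded_solution`). In `L^{pρ}`, where `K` is bounded by Schur's
test, the estimate for differences gives continuous dependence on the data. Bounded functions being
dense, the approximate solutions are uniformly Cauchy on `[0,T]` for arbitrary `u₀`
(`exists_forall_norm_sub_le_of_bounded_solutions`). Since `u ↦ Lu + f(·,u)` is continuous from
`L^{pρ}` to `L^p`, the limit solves the equation in `L^p` (`exists_limit_solution`). In `L^p`, the
estimate for differences gives uniqueness (`IsStrongSolution.eqOn`).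

The same continuity makes mild and strong solutions coincide, and uniqueness glues the solutions on
bounded intervals into a global one. -/

namespace NonlocalDiffusion

/-! ### Real functions with a.e. derivative bounds; Carathéodory functions -/

/-- A Lipschitz function whose derivative is a.e. at most `B` grows at rate at most `B`. -/
lemma sub_le_of_ae_deriv_le {g : ℝ → ℝ} {a b B : ℝ} {M : ℝ≥0} (hab : a ≤ b)
    (hg : LipschitzOnWith M g (Icc a b)) (hB : ∀ᵐ s, s ∈ Icc a b → deriv g s ≤ B) :
    g b - g a ≤ B * (b - a) := by
  have hac : AbsolutelyContinuousOnInterval g a b :=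
    LipschitzOnWith.absolutelyContinuousOnInterval (by rwa [uIcc_of_le hab])
  rw [← hac.integral_deriv_eq_sub]
  have h1 : ∫ x in a..b, deriv g x ≤ ∫ _ in a..b, B := by
    apply intervalIntegral.integral_mono_ae_restrict hab hac.intervalIntegrable_deriv
      intervalIntegrable_const
    exact (ae_restrict_iff' measurableSet_Icc).2 hB
  simpa [mul_comm] using h1

lemma abs_sub_le_of_ae_abs_deriv_le {g : ℝ → ℝ} {a b B : ℝ} {M : ℝ≥0} (hab : a ≤ b)
    (hg : LipschitzOnWith M g (Icc a b)) (hB : ∀ᵐ s, s ∈ Icc a b → |deriv g s| ≤ B) :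
    |g b - g a| ≤ B * (b - a) := by
  refine abs_le.2 ⟨?_, sub_le_of_ae_deriv_le hab hg
    (hB.mono fun s hs h => (le_abs_self _).trans (hs h))⟩
  have h1 := sub_le_of_ae_deriv_le (g := -g) (B := B) hab hg.neg (hB.mono fun s hs h => by
    rw [deriv.neg]; exact (neg_le_abs _).trans (hs h))
  simp only [Pi.neg_apply] at h1
  linarith

/-- One-sided Lipschitz estimate, from an a.e. upper bound on the derivative. -/
lemma mul_sub_le_of_ae_deriv_le {g : ℝ → ℝ} {B : ℝ}
    (hg : ∀ n : ℕ, ∃ M : ℝ≥0, LipschitzOnWith M g (Icc (-(n : ℝ)) n))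
    (hB : ∀ᵐ s, deriv g s ≤ B) (s r : ℝ) : (g s - g r) * (s - r) ≤ B * (s - r) ^ 2 := by
  wlog hrs : r ≤ s generalizing s r
  · have := this r s (le_of_not_ge hrs)
    nlinarith
  obtain ⟨n, hn⟩ := exists_nat_ge (max |s| |r|)
  obtain ⟨M, hM⟩ := hg n
  have hs := abs_le.1 ((le_max_left _ _).trans hn)
  have hr := abs_le.1 ((le_max_right _ _).trans hn)
  have h1 := sub_le_of_ae_deriv_le hrs (hM.mono (Icc_subset_Icc hr.1 hs.2))
    (hB.mono fun _ h _ => h)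
  nlinarith

/-- Polynomial local Lipschitz estimate, from an a.e. polynomial bound on the derivative. -/
lemma abs_sub_le_of_ae_abs_deriv_le_rpow {g : ℝ → ℝ} {C e : ℝ} (he : 0 ≤ e) (hC : 0 ≤ C)
    (hg : ∀ n : ℕ, ∃ M : ℝ≥0, LipschitzOnWith M g (Icc (-(n : ℝ)) n))
    (hB : ∀ᵐ s, |deriv g s| ≤ C * (1 + |s| ^ e)) (s r : ℝ) :
    |g s - g r| ≤ C * (1 + |s| ^ e + |r| ^ e) * |s - r| := by
  wlog hrs : r ≤ s generalizing s r
  · have := this r s (le_of_not_ge hrs)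
    rw [abs_sub_comm, abs_sub_comm s r]
    convert this using 2
    ring
  obtain ⟨n, hn⟩ := exists_nat_ge (max |s| |r|)
  obtain ⟨M, hM⟩ := hg n
  have hs := abs_le.1 ((le_max_left _ _).trans hn)
  have hr := abs_le.1 ((le_max_right _ _).trans hn)
  rw [abs_of_nonneg (sub_nonneg.2 hrs)]
  refine abs_sub_le_of_ae_abs_deriv_le hrs (hM.mono (Icc_subset_Icc hr.1 hs.2))
    (hB.mono fun x hx hxI => hx.trans ?_)
  rw [add_assoc]
  refine mul_le_mul_of_nonneg_left (add_le_add_right ?_ 1) hC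
  have hx' : |x| ≤ max |s| |r| := by
    rw [max_comm]; exact abs_le_max_abs_abs hxI.1 hxI.2
  calc |x| ^ e ≤ (max |s| |r|) ^ e := Real.rpow_le_rpow (abs_nonneg _) hx' he
    _ ≤ |s| ^ e + |r| ^ e := by
      rcases max_choice |s| |r| with h | h <;> rw [h]
      · linarith [Real.rpow_nonneg (abs_nonneg r) e]
      · linarith [Real.rpow_nonneg (abs_nonneg s) e]

/-- A Carathéodory function composed with a measurable function is measurable. -/
lemma aestronglyMeasurable_comp_of_ae_continuous {Ω : Type*} [MeasurableSpace Ω] {μ : Measure Ω}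
    {f : Ω → ℝ → ℝ} (hf : ∀ s, AEStronglyMeasurable (fun x => f x s) μ)
    (hc : ∀ᵐ x ∂μ, Continuous (f x)) {u : Ω → ℝ} (hu : AEStronglyMeasurable u μ) :
    AEStronglyMeasurable (fun x => f x (u x)) μ := by
  -- For simple `w` the composition is a finite sum over the fibres of `w`. Continuity of `f x` then
  -- passes to the limit along simple approximations.
  have hs : ∀ w : SimpleFunc Ω ℝ, AEStronglyMeasurable (fun x => f x (w x)) μ := by
    intro w
    have h1 : (fun x => f x (w x)) =
        fun x => ∑ c ∈ w.range, (w ⁻¹' {c}).indicator (fun x => f x c) x := by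
      funext x
      rw [Finset.sum_eq_single (w x)]
      · simp
      · intro c _ hcw
        exact indicator_of_notMem (fun h => hcw (by simpa using h.symm)) _
      · intro h; exact absurd (w.mem_range_self x) h
    rw [h1]
    exact Finset.aestronglyMeasurable_fun_sum _ fun c _ =>
      (hf c).indicator (w.measurableSet_fiber c)
  have h2 : AEStronglyMeasurable (fun x => f x (hu.mk u x)) μ := by
    refine aestronglyMeasurable_of_tendsto_ae atTop
      (fun n => hs (hu.stronglyMeasurable_mk.approx n)) ?_
    filter_upwards [hc] with x hx
    exact (hx.tendsto _).comp (hu.stronglyMeasurable_mk.tendsto_approx x)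
  refine h2.congr ?_
  filter_upwards [hu.ae_eq_mk] with x hx
  rw [hx]

/-! ### Dissipative Grönwall inequality -/

/-- Grönwall's inequality for a left-differentiable curve whose velocity satisfies a dissipativity
estimate, expressed through the resolvent-type inequality `(1 - δ ω) ‖w‖ ≤ ‖w - δ w'‖ + δ ε`. -/
lemma norm_le_of_dissipative {E : Type*} [NormedAddCommGroup E] [NormedSpace ℝ E] {T ω ε : ℝ}
    (hT : 0 ≤ T) (hω : 0 < ω) {w w' : ℝ → E}
    (hw : ∀ t ∈ Icc 0 T, HasDerivWithinAt w (w' t) (Icc 0 T) t)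
    (hd : ∀ t ∈ Icc 0 T, ∀ δ > 0, (1 - δ * ω) * ‖w t‖ ≤ ‖w t - δ • w' t‖ + δ * ε) :
    ‖w T‖ ≤ Real.exp (ω * T) * ‖w 0‖ + ε / ω * (Real.exp (ω * T) - 1) := by
  have hcont : ContinuousOn w (Icc 0 T) := fun t ht => (hw t ht).continuousWithinAt
  have hmaps : MapsTo (fun s => T - s) (Icc 0 T) (Icc 0 T) := fun s hs => by
    constructor <;> linarith [hs.1, hs.2]
  -- Dissipativity compares `w t` with `w (t - δ) ≈ w t - δ w' t`, a backward difference, while the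
  -- Grönwall lemma uses forward ones. Time is therefore reversed, and the sign changed so that the
  -- estimate is again an upper bound.
  have key := le_gronwallBound_of_liminf_deriv_right_le (a := 0) (b := T)
    (f := fun s => -‖w (T - s)‖) (f' := fun s => ω * ‖w (T - s)‖ + ε)
    (δ := -‖w T‖) (K := -ω) (ε := ε)
    ((hcont.comp (by fun_prop) hmaps).norm.neg) ?_ (by simp) (fun x _ => by
      apply le_of_eq; ring) T ⟨hT, le_rfl⟩
  · rw [gronwallBound_of_K_ne_0 (by linarith), sub_self, sub_zero] at key
    have e1 : Real.exp (ω * T) * Real.exp (-ω * T) = 1 := by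
      rw [← Real.exp_add]; simp
    have e2 := mul_le_mul_of_nonneg_left key (Real.exp_pos (ω * T)).le
    have e3 : Real.exp (ω * T) * (-‖w T‖ * Real.exp (-ω * T) + ε / -ω * (Real.exp (-ω * T) - 1))
        = -‖w T‖ + ε / ω * (Real.exp (ω * T) - 1) := by
      have : Real.exp (ω * T) * (-‖w T‖ * Real.exp (-ω * T) + ε / -ω * (Real.exp (-ω * T) - 1))
        = -‖w T‖ * (Real.exp (ω * T) * Real.exp (-ω * T)) -
          ε / ω * (Real.exp (ω * T) * Real.exp (-ω * T) - Real.exp (ω * T)) := by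
        rw [div_neg]; ring
      rw [this, e1]; ring
    rw [e3] at e2
    linarith
  · intro s hs r hr
    have hts : T - s ∈ Icc 0 T := hmaps ⟨hs.1, hs.2.le⟩
    have hder : HasDerivWithinAt (fun z => w (T - z)) (-(w' (T - s))) (Icc 0 T) s := by
      have := (hw _ hts).scomp s ((hasDerivWithinAt_id s (Icc 0 T)).const_sub T) hmaps
      rwa [neg_one_smul] at this
    have hder' : HasDerivWithinAt (fun z => w (T - z)) (-(w' (T - s))) (Ioi s) s := by
      refine hder.mono_of_mem_nhdsWithin ?_
      filter_upwards [Ioo_mem_nhdsGT hs.2] with z hz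
      exact ⟨hs.1.trans hz.1.le, hz.2.le⟩
    have hlo := hasDerivWithinAt_iff_isLittleO.1 hder'
    apply Eventually.frequently
    have hη : 0 < r - (ω * ‖w (T - s)‖ + ε) := by linarith
    filter_upwards [hlo.def (half_pos hη), self_mem_nhdsWithin] with z hz hzs
    have hδ : 0 < z - s := sub_pos.2 hzs
    have h1 := hd _ hts (z - s) hδ
    rw [Real.norm_of_nonneg hδ.le] at hz
    have h2 : ‖w (T - s) - (z - s) • w' (T - s)‖ ≤
        ‖w (T - z)‖ + (r - (ω * ‖w (T - s)‖ + ε)) / 2 * (z - s) := by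
      have : w (T - s) - (z - s) • w' (T - s) =
        w (T - z) - (w (T - z) - w (T - s) - (z - s) • -w' (T - s)) := by
        rw [smul_neg]; abel
      rw [this]
      exact (norm_sub_le _ _).trans (by linarith)
    rw [inv_mul_lt_iff₀ hδ]
    nlinarith [mul_pos hδ hη]

/-! ### Inclusions and dissipativity in `L^r` -/

section Lp

variable {Ω : Type*} [MeasurableSpace Ω] {μ : Measure Ω}

/-- The continuous inclusion `L^s(Ω) ⊆ L^r(Ω)`, for `r ≤ s`, on a finite measure space. -/
noncomputable def lpIncl [IsFiniteMeasure μ] {r s : ℝ≥0∞} [Fact (1 ≤ r)] [Fact (1 ≤ s)]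
    (hrs : r ≤ s) : Lp ℝ s μ →L[ℝ] Lp ℝ r μ :=
  LinearMap.mkContinuous
    { toFun := fun v => AddSubgroup.inclusion (Lp.antitone hrs) v
      map_add' := fun _ _ => rfl
      map_smul' := fun _ _ => rfl }
    (μ univ ^ (1 / r.toReal - 1 / s.toReal)).toReal
    (fun v => by
      have h1 := eLpNorm_le_eLpNorm_mul_rpow_measure_univ hrs (Lp.memLp v).1
      rw [mul_comm] at h1
      have hexp : 0 ≤ 1 / r.toReal - 1 / s.toReal := by
        rcases eq_or_ne s ⊤ with rfl | hs
        · simp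
        · have hr : 0 < r.toReal := ENNReal.toReal_pos
            (zero_lt_one.trans_le (Fact.out : 1 ≤ r)).ne' (ne_top_of_le_ne_top hs hrs)
          exact sub_nonneg.2 (one_div_le_one_div_of_le hr (ENNReal.toReal_mono hs hrs))
      rw [Lp.norm_def v, ← ENNReal.toReal_mul]
      exact ENNReal.toReal_mono (ENNReal.mul_lt_top
        (ENNReal.rpow_lt_top_of_nonneg hexp (measure_ne_top _ _)) (Lp.memLp v).2).ne h1)

lemma coeFn_lpIncl [IsFiniteMeasure μ] {r s : ℝ≥0∞} [Fact (1 ≤ r)] [Fact (1 ≤ s)]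
    (hrs : r ≤ s) (v : Lp ℝ s μ) : (lpIncl hrs v : Ω → ℝ) = v := rfl

lemma lpIncl_injective [IsFiniteMeasure μ] {r s : ℝ≥0∞} [Fact (1 ≤ r)] [Fact (1 ≤ s)]
    (hrs : r ≤ s) : Function.Injective (lpIncl hrs : Lp ℝ s μ → Lp ℝ r μ) :=
  AddSubgroup.inclusion_injective (Lp.antitone hrs)

variable {r : ℝ≥0∞} [Fact (1 ≤ r)]

/-- Multiplication by a function bounded above is dissipative in every `L^r`. -/
lemma one_sub_mul_norm_le {w g : Lp ℝ r μ} {b δ : ℝ} (hδ : 0 ≤ δ)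
    (hb : ∀ᵐ x ∂μ, g x * w x ≤ b * w x ^ 2) : (1 - δ * b) * ‖w‖ ≤ ‖w - δ • g‖ := by
  rcases le_total (1 - δ * b) 0 with h0 | h0
  · exact (mul_nonpos_of_nonpos_of_nonneg h0 (norm_nonneg _)).trans (norm_nonneg _)
  · rw [← Real.norm_of_nonneg h0, ← norm_smul]
    refine Lp.norm_le_norm_of_ae_le ?_
    filter_upwards [hb, Lp.coeFn_smul (1 - δ * b) w, Lp.coeFn_sub w (δ • g),
      Lp.coeFn_smul δ g] with x hx h1 h2 h3
    rw [h1, h2, Pi.sub_apply, h3, Pi.smul_apply, Pi.smul_apply, smul_eq_mul, smul_eq_mul,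
      Real.norm_eq_abs, Real.norm_eq_abs, abs_mul, abs_of_nonneg h0]
    -- Pointwise, `(w - δ g) w ≥ (1 - δ b) w²`; dividing by `|w|` gives the claim. Only monotonicity
    -- of the norm is used, so the exponent is arbitrary, `∞` included.
    rcases eq_or_ne (w x) 0 with hw | hw
    · rw [hw]; simp [mul_nonneg]
    · have hpos := abs_pos.2 hw
      refine le_of_mul_le_mul_right ?_ hpos
      rw [← abs_mul]
      refine le_trans ?_ (le_abs_self _)
      rw [mul_assoc, ← sq, sq_abs]
      nlinarith [mul_le_mul_of_nonneg_left hx hδ]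

/-- A priori estimate in `L^r` for a curve whose velocity is the sum of a bounded part `κ`, a
dissipative part `g` and an error `e`. -/
lemma norm_le_of_velocity_decomposition {T c b ε : ℝ} (hcb : 0 < c + b) {w w' : ℝ → Lp ℝ r μ}
    (hw : ∀ t ∈ Icc 0 T, HasDerivWithinAt w (w' t) (Icc 0 T) t)
    (hd : ∀ t ∈ Icc 0 T, ∃ κ g e : Lp ℝ r μ, w' t = κ + g + e ∧ ‖κ‖ ≤ c * ‖w t‖ ∧ ‖e‖ ≤ ε ∧
      ∀ᵐ x ∂μ, g x * w t x ≤ b * w t x ^ 2) {t : ℝ} (ht : t ∈ Icc 0 T) :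
    ‖w t‖ ≤ Real.exp ((c + b) * t) * ‖w 0‖ + ε / (c + b) * (Real.exp ((c + b) * t) - 1) := by
  have hsub : Icc 0 t ⊆ Icc 0 T := Icc_subset_Icc_right ht.2
  refine norm_le_of_dissipative ht.1 hcb (fun s hs => (hw s (hsub hs)).mono hsub) ?_
  intro s hs δ hδ
  obtain ⟨κ, g, e, h1, h2, h3, h4⟩ := hd s (hsub hs)
  have h5 := one_sub_mul_norm_le hδ.le h4
  have h6 : w s - δ • g = w s - δ • w' s + (δ • κ + δ • e) := by
    rw [h1, smul_add, smul_add]; abel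
  have h7 : ‖w s - δ • g‖ ≤ ‖w s - δ • w' s‖ + (δ * ‖κ‖ + δ * ‖e‖) := by
    rw [h6]
    refine (norm_add_le _ _).trans (add_le_add_right ((norm_add_le _ _).trans ?_) _)
    rw [norm_smul, norm_smul, Real.norm_of_nonneg hδ.le]
  nlinarith [mul_le_mul_of_nonneg_left h2 hδ.le, mul_le_mul_of_nonneg_left h3 hδ.le]

end Lp

/-! ### Schur's test for the kernel -/

section Schur

variable {Ω : Type*} [MeasurableSpace Ω] {μ : Measure Ω} [SFinite μ] {J : Ω → Ω → ℝ}

/-- Schur's test. -/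
lemma eLpNorm_integral_kernel_le {c : ℝ≥0}
    (hJ : AEStronglyMeasurable (Function.uncurry J) (μ.prod μ))
    (hrow : ∀ᵐ x ∂μ, ∫⁻ y, ‖J x y‖ₑ ∂μ ≤ c) (hcol : ∀ᵐ y ∂μ, ∫⁻ x, ‖J x y‖ₑ ∂μ ≤ c)
    {q : ℝ≥0∞} (hq : 1 < q) (hq' : q ≠ ⊤) {v : Ω → ℝ} (hv : AEStronglyMeasurable v μ) :
    eLpNorm (fun x => ∫ y, J x y * v y ∂μ) q μ ≤ c * eLpNorm v q μ := by
  have hq0 : q ≠ 0 := (zero_lt_one.trans hq).ne'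
  rw [eLpNorm_eq_lintegral_rpow_enorm_toReal hq0 hq', eLpNorm_eq_lintegral_rpow_enorm_toReal hq0 hq']
  set a := q.toReal with ha
  have ha1 : 1 < a := by
    rw [ha, ← ENNReal.toReal_one]
    exact (ENNReal.toReal_lt_toReal ENNReal.one_ne_top hq').2 hq
  have ha0 : 0 < a := zero_lt_one.trans ha1
  have hconj := (Real.HolderConjugate.conjExponent ha1).symm
  set b := a.conjExponent
  have hb0 : 0 < b := hconj.pos
  have hpt : ∀ᵐ x ∂μ, ‖∫ y, J x y * v y ∂μ‖ₑ ^ a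
      ≤ (c : ℝ≥0∞) ^ (a / b) * ∫⁻ y, ‖J x y‖ₑ * ‖v y‖ₑ ^ a ∂μ := by
    filter_upwards [hrow, hJ.prodMk_left] with x hx hm
    have hm' : AEStronglyMeasurable (J x) μ := hm
    -- Split `|J| = |J|^{1/b} |J|^{1/a}` and apply Hölder: the first factor yields the row sum, and
    -- the second keeps one power of `|J|` for the column sum after Tonelli.
    have h1 : ‖∫ y, J x y * v y ∂μ‖ₑ ≤
        ∫⁻ y, ((fun y => ‖J x y‖ₑ ^ (1 / b)) * fun y => ‖J x y‖ₑ ^ (1 / a) * ‖v y‖ₑ) y ∂μ := by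
      refine (enorm_integral_le_lintegral_enorm _).trans (lintegral_mono fun y => ?_)
      rw [enorm_mul, Pi.mul_apply, ← mul_assoc, ← ENNReal.rpow_add_of_nonneg _ _ (by positivity)
        (by positivity), one_div, one_div, hconj.inv_add_inv_eq_one, ENNReal.rpow_one]
    have h2 := h1.trans (ENNReal.lintegral_mul_le_Lp_mul_Lq μ hconj
      (hm'.enorm.pow_const _) ((hm'.enorm.pow_const _).mul hv.enorm))
    have e1 : ∀ y, (‖J x y‖ₑ ^ (1 / b)) ^ b = ‖J x y‖ₑ := fun y => by
      rw [← ENNReal.rpow_mul, one_div_mul_cancel hb0.ne', ENNReal.rpow_one]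
    have e2 : ∀ y, (‖J x y‖ₑ ^ (1 / a) * ‖v y‖ₑ) ^ a = ‖J x y‖ₑ * ‖v y‖ₑ ^ a := fun y => by
      rw [ENNReal.mul_rpow_of_nonneg _ _ ha0.le, ← ENNReal.rpow_mul, one_div_mul_cancel ha0.ne',
        ENNReal.rpow_one]
    simp only [e1, e2] at h2
    refine (ENNReal.rpow_le_rpow h2 ha0.le).trans ?_
    rw [ENNReal.mul_rpow_of_nonneg _ _ ha0.le, ← ENNReal.rpow_mul, ← ENNReal.rpow_mul,
      one_div_mul_cancel ha0.ne', ENNReal.rpow_one, one_div_mul_eq_div]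
    gcongr
  have hmeas : AEMeasurable (Function.uncurry fun x y => ‖J x y‖ₑ * ‖v y‖ₑ ^ a) (μ.prod μ) :=
    hJ.enorm.mul (hv.comp_snd.enorm.pow_const a)
  have hint : ∫⁻ x, ‖∫ y, J x y * v y ∂μ‖ₑ ^ a ∂μ ≤ (c : ℝ≥0∞) ^ a * ∫⁻ y, ‖v y‖ₑ ^ a ∂μ := by
    have hca : (c : ℝ≥0∞) ^ (a / b) ≠ ⊤ :=
      (ENNReal.rpow_lt_top_of_nonneg (by positivity) ENNReal.coe_ne_top).ne
    calc ∫⁻ x, ‖∫ y, J x y * v y ∂μ‖ₑ ^ a ∂μ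
        ≤ ∫⁻ x, (c : ℝ≥0∞) ^ (a / b) * ∫⁻ y, ‖J x y‖ₑ * ‖v y‖ₑ ^ a ∂μ ∂μ := lintegral_mono_ae hpt
      _ = (c : ℝ≥0∞) ^ (a / b) * ∫⁻ y, ∫⁻ x, ‖J x y‖ₑ * ‖v y‖ₑ ^ a ∂μ ∂μ := by
        rw [lintegral_const_mul' _ _ hca, lintegral_lintegral_swap hmeas]
      _ ≤ (c : ℝ≥0∞) ^ (a / b) * ∫⁻ y, c * ‖v y‖ₑ ^ a ∂μ := by
        gcongr 1
        refine lintegral_mono_ae ?_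
        have hJs : AEStronglyMeasurable (fun z : Ω × Ω => J z.2 z.1) (μ.prod μ) := hJ.prod_swap
        filter_upwards [hcol, hJs.prodMk_left] with y hy hm
        have hm' : AEStronglyMeasurable (fun x => J x y) μ := hm
        rw [lintegral_mul_const'' _ hm'.enorm]
        gcongr
      _ = (c : ℝ≥0∞) ^ a * ∫⁻ y, ‖v y‖ₑ ^ a ∂μ := by
        rw [lintegral_const_mul' _ _ ENNReal.coe_ne_top, ← mul_assoc]
        congr 1
        nth_rw 2 [← ENNReal.rpow_one (c : ℝ≥0∞)]
        rw [← ENNReal.rpow_add_of_nonneg _ _ (by positivity) zero_le_one]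
        congr 1
        have := hconj.inv_add_inv_eq_one
        field_simp at this ⊢
        linarith
  refine (ENNReal.rpow_le_rpow hint (by positivity)).trans_eq ?_
  rw [ENNReal.mul_rpow_of_nonneg _ _ (by positivity), ← ENNReal.rpow_mul,
    mul_one_div_cancel ha0.ne', ENNReal.rpow_one]

/-- A symmetric kernel in `L^∞(Ω, L^1(Ω))` has bounded row and column sums. -/
lemma KernelMemLp.exists_lintegral_enorm_le (hJ : KernelMemLp J ⊤ 1 μ)
    (hsymm : ∀ᵐ z ∂(μ.prod μ), J z.1 z.2 = J z.2 z.1) :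
    ∃ c : ℝ≥0, (∀ᵐ x ∂μ, ∫⁻ y, ‖J x y‖ₑ ∂μ ≤ c) ∧ ∀ᵐ y ∂μ, ∫⁻ x, ‖J x y‖ₑ ∂μ ≤ c := by
  have hrow : ∀ᵐ x ∂μ, ∫⁻ y, ‖J x y‖ₑ ∂μ ≤
      (eLpNorm (fun x => eLpNorm (J x) 1 μ) ⊤ μ).toNNReal := by
    rw [ENNReal.coe_toNNReal hJ.2.ne, eLpNorm_exponent_top]
    filter_upwards [enorm_ae_le_eLpNormEssSup (fun x => eLpNorm (J x) 1 μ) μ] with x hx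
    rwa [enorm_eq_self, eLpNorm_one_eq_lintegral_enorm] at hx
  refine ⟨_, hrow, ?_⟩
  filter_upwards [hrow, Measure.ae_ae_of_ae_prod hsymm] with y hy hs
  refine le_trans (le_of_eq (lintegral_congr_ae ?_)) hy
  filter_upwards [hs] with x hx
  rw [hx]

end Schur

/-! ### The reaction term and its Nemytskii operator -/

/-- A reaction term which is Carathéodory, one-sided Lipschitz, locally Lipschitz with polynomial
constants, and bounded at `0`, with explicit constants. -/
structure IsReaction {Ω : Type*} [MeasurableSpace Ω] (μ : Measure Ω) (f : Ω → ℝ → ℝ)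
    (b C m e : ℝ) : Prop where
  aestronglyMeasurable : ∀ s, AEStronglyMeasurable (fun x => f x s) μ
  b_nonneg : 0 ≤ b
  C_nonneg : 0 ≤ C
  m_nonneg : 0 ≤ m
  e_pos : 0 < e
  mul_sub_le : ∀ᵐ x ∂μ, ∀ s r, (f x s - f x r) * (s - r) ≤ b * (s - r) ^ 2
  abs_sub_le : ∀ᵐ x ∂μ, ∀ s r, |f x s - f x r| ≤ C * (1 + |s| ^ e + |r| ^ e) * |s - r|
  abs_zero_le : ∀ᵐ x ∂μ, |f x 0| ≤ m

lemma ae_abs_le_of_memLp_top {Ω : Type*} [MeasurableSpace Ω] {μ : Measure Ω} {g : Ω → ℝ}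
    (hg : MemLp g ⊤ μ) : ∀ᵐ x ∂μ, |g x| ≤ (eLpNorm g ⊤ μ).toReal := by
  filter_upwards [enorm_ae_le_eLpNormEssSup g μ] with x hx
  rw [← eLpNorm_exponent_top] at hx
  have := ENNReal.toReal_mono hg.2.ne hx
  rwa [toReal_enorm] at this

/-- All that the proof needs of the derivative hypotheses. Integrating the a.e. bounds is legitimate
because `f x` is Lipschitz on bounded intervals; `β` is replaced by its essential supremum norm, and
`C` by `|C|`. -/
lemma isReaction_of_ae_deriv {Ω : Type*} [MeasurableSpace Ω] {μ : Measure Ω} {ρ : ℝ} (hρ : 1 < ρ)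
    {f : Ω → ℝ → ℝ} (hfmeas : ∀ s : ℝ, AEStronglyMeasurable (fun x => f x s) μ)
    (hfLip : ∀ R : ℝ, ∃ M : ℝ≥0, ∀ᵐ x ∂μ, LipschitzOnWith M (f x) (Icc (-R) R))
    (hf0 : MemLp (fun x => f x 0) ⊤ μ) {β : Ω → ℝ} (hβ : MemLp β ⊤ μ)
    (hfβ : ∀ᵐ x ∂μ, ∀ᵐ s : ℝ, deriv (f x) s ≤ β x) {C : ℝ}
    (hfC : ∀ᵐ x ∂μ, ∀ᵐ s : ℝ, |deriv (f x) s| ≤ C * (1 + |s| ^ (ρ - 1))) :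
    IsReaction μ f (eLpNorm β ⊤ μ).toReal |C| (eLpNorm (fun x => f x 0) ⊤ μ).toReal (ρ - 1) := by
  have hlip : ∀ᵐ x ∂μ, ∀ n : ℕ, ∃ M : ℝ≥0, LipschitzOnWith M (f x) (Icc (-(n : ℝ)) n) := by
    rw [ae_all_iff]
    intro n
    obtain ⟨M, hM⟩ := hfLip n
    exact hM.mono fun x hx => ⟨M, hx⟩
  refine ⟨hfmeas, ENNReal.toReal_nonneg, abs_nonneg C, ENNReal.toReal_nonneg, by linarith, ?_, ?_,
    ae_abs_le_of_memLp_top hf0⟩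
  · filter_upwards [hlip, hfβ, ae_abs_le_of_memLp_top hβ] with x h1 h2 h3
    exact mul_sub_le_of_ae_deriv_le h1 (h2.mono fun s hs => hs.trans ((le_abs_self _).trans h3))
  · filter_upwards [hlip, hfC] with x h1 h2
    refine abs_sub_le_of_ae_abs_deriv_le_rpow (by linarith) (abs_nonneg C) h1
      (h2.mono fun s hs => hs.trans ?_)
    have : 0 ≤ |s| ^ (ρ - 1) := Real.rpow_nonneg (abs_nonneg s) _
    exact mul_le_mul_of_nonneg_right (le_abs_self C) (by linarith)

namespace IsReaction

variable {Ω : Type*} [MeasurableSpace Ω] {μ : Measure Ω} {f : Ω → ℝ → ℝ} {b C m e : ℝ}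

lemma ae_abs_sub_le_of_abs_le (hf : IsReaction μ f b C m e) :
    ∀ᵐ x ∂μ, ∀ R s r : ℝ, |s| ≤ R → |r| ≤ R →
      |f x s - f x r| ≤ C * (1 + R ^ e + R ^ e) * |s - r| := by
  filter_upwards [hf.abs_sub_le] with x hx R s r hs hr
  refine (hx s r).trans ?_
  have := hf.C_nonneg
  have := hf.e_pos.le
  gcongr

lemma ae_continuous (hf : IsReaction μ f b C m e) : ∀ᵐ x ∂μ, Continuous (f x) := by
  filter_upwards [hf.ae_abs_sub_le_of_abs_le] with x hx
  rw [continuous_iff_continuousAt]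
  intro s
  have hR : ContinuousOn (f x) (Icc (-(|s| + 1)) (|s| + 1)) := by
    refine LipschitzOnWith.continuousOn (K := (C * (1 + (|s| + 1) ^ e + (|s| + 1) ^ e)).toNNReal)
      (LipschitzOnWith.of_dist_le_mul fun a ha c hc => ?_)
    rw [Real.dist_eq, Real.dist_eq]
    exact (hx _ a c (abs_le.2 ha) (abs_le.2 hc)).trans
      (mul_le_mul_of_nonneg_right (Real.le_coe_toNNReal _) (abs_nonneg _))
  exact hR.continuousAt (Icc_mem_nhds (by linarith [neg_abs_le s]) (by linarith [le_abs_self s]))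

lemma aestronglyMeasurable_comp (hf : IsReaction μ f b C m e) {u : Ω → ℝ}
    (hu : AEStronglyMeasurable u μ) : AEStronglyMeasurable (fun x => f x (u x)) μ :=
  aestronglyMeasurable_comp_of_ae_continuous hf.aestronglyMeasurable hf.ae_continuous hu

lemma memLp_zero [IsFiniteMeasure μ] (hf : IsReaction μ f b C m e) (r : ℝ≥0∞) :
    MemLp (fun x => f x 0) r μ :=
  MemLp.of_bound (hf.aestronglyMeasurable 0) m hf.abs_zero_le

variable {p : ℝ≥0∞} [Fact (1 ≤ p)] {ρ : ℝ} [hρ : Fact (1 < ρ)]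

/-- Hölder with `1/p = (ρ-1)/(pρ) + 1/(pρ)`: the polynomial Lipschitz factor lies in `L^{pρ/(ρ-1)}`
and the difference in `L^{pρ}`. -/
lemma eLpNorm_sub_le (hf : IsReaction μ f b C m (ρ - 1)) (hp : p ≠ ⊤) {u v : Ω → ℝ}
    (hu : MemLp u (p * ENNReal.ofReal ρ) μ) (hv : MemLp v (p * ENNReal.ofReal ρ) μ) :
    eLpNorm (fun x => f x (u x) - f x (v x)) p μ ≤
      ENNReal.ofReal C *
        (eLpNorm (fun _ => (1 : ℝ)) (p * ENNReal.ofReal ρ / ENNReal.ofReal (ρ - 1)) μ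
          + eLpNorm u (p * ENNReal.ofReal ρ) μ ^ (ρ - 1)
          + eLpNorm v (p * ENNReal.ofReal ρ) μ ^ (ρ - 1))
        * eLpNorm (fun x => u x - v x) (p * ENNReal.ofReal ρ) μ := by
  have hp1 : 1 ≤ p := Fact.out
  have hp0 : p ≠ 0 := (zero_lt_one.trans_le hp1).ne'
  have hρ1 := hρ.out
  have he : 0 < ρ - 1 := by linarith
  set q := p * ENNReal.ofReal ρ with hq
  have hρ0 : ENNReal.ofReal ρ ≠ 0 := by simpa using by linarith
  have he0 : ENNReal.ofReal (ρ - 1) ≠ 0 := by simpa using by linarith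
  have hq0 : q ≠ 0 := mul_ne_zero hp0 hρ0
  have hqt : q ≠ ⊤ := ENNReal.mul_ne_top hp ENNReal.ofReal_ne_top
  have hsum : ENNReal.ofReal (ρ - 1) + 1 = ENNReal.ofReal ρ := by
    rw [← ENNReal.ofReal_one, ← ENNReal.ofReal_add he.le zero_le_one]; simp
  set s := q / ENNReal.ofReal (ρ - 1) with hs
  have hse : s * ENNReal.ofReal (ρ - 1) = q := ENNReal.div_mul_cancel he0 ENNReal.ofReal_ne_top
  have hs1 : 1 ≤ s := by
    rw [hs, ENNReal.le_div_iff_mul_le (Or.inl he0) (Or.inl ENNReal.ofReal_ne_top), one_mul]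
    calc ENNReal.ofReal (ρ - 1) ≤ ENNReal.ofReal ρ := ENNReal.ofReal_le_ofReal (by linarith)
      _ ≤ q := le_mul_of_one_le_left zero_le hp1
  have : ENNReal.HolderTriple s q p := ⟨by
    rw [hs, ENNReal.inv_div (Or.inl ENNReal.ofReal_ne_top) (Or.inl he0), ← one_div q,
      ENNReal.div_add_div_same, hsum, hq, mul_comm, ← one_div,
      ← ENNReal.mul_div_mul_left 1 p hρ0 ENNReal.ofReal_ne_top, mul_one]⟩
  have hpow : ∀ w : Ω → ℝ, eLpNorm (fun x => ‖w x‖ ^ (ρ - 1)) s μ = eLpNorm w q μ ^ (ρ - 1) := by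
    intro w
    rw [eLpNorm_norm_rpow w he, hse]
  have hmpow : ∀ {w : Ω → ℝ}, AEStronglyMeasurable w μ →
      AEStronglyMeasurable (fun x => ‖w x‖ ^ (ρ - 1)) μ := fun hw =>
    (Real.continuous_rpow_const he.le).comp_aestronglyMeasurable hw.norm
  set W : Ω → ℝ := (fun _ => (1 : ℝ)) + (fun x => ‖u x‖ ^ (ρ - 1)) + fun x => ‖v x‖ ^ (ρ - 1)
    with hW
  have hWm : AEStronglyMeasurable W μ :=
    (aestronglyMeasurable_const.add (hmpow hu.1)).add (hmpow hv.1)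
  have hWn : eLpNorm W s μ ≤ eLpNorm (fun _ => (1 : ℝ)) s μ + eLpNorm u q μ ^ (ρ - 1)
      + eLpNorm v q μ ^ (ρ - 1) := by
    rw [← hpow u, ← hpow v]
    refine (eLpNorm_add_le (aestronglyMeasurable_const.add (hmpow hu.1)) (hmpow hv.1) hs1).trans ?_
    gcongr
    exact eLpNorm_add_le aestronglyMeasurable_const (hmpow hu.1) hs1
  have h1 : eLpNorm (fun x => f x (u x) - f x (v x)) p μ ≤
      ENNReal.ofReal C * eLpNorm (W • (u - v)) p μ := by
    apply eLpNorm_le_mul_eLpNorm_of_ae_le_mul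
    filter_upwards [hf.abs_sub_le] with x hx
    refine (hx _ _).trans (le_of_eq ?_)
    have hWx : 0 ≤ W x := by
      simp only [hW, Pi.add_apply]; positivity
    rw [Pi.smul_apply', smul_eq_mul, norm_mul, Real.norm_of_nonneg hWx, mul_assoc]
    rfl
  refine h1.trans ?_
  rw [mul_assoc]
  gcongr
  refine (eLpNorm_smul_le_mul_eLpNorm (p := s) (q := q) (hu.1.sub hv.1) hWm).trans ?_
  exact mul_le_mul' hWn le_rfl

variable [IsFiniteMeasure μ]

lemma memLp_comp (hf : IsReaction μ f b C m (ρ - 1)) (hp : p ≠ ⊤) {u : Ω → ℝ}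
    (hu : MemLp u (p * ENNReal.ofReal ρ) μ) : MemLp (fun x => f x (u x)) p μ := by
  have he : 0 ≤ ρ - 1 := by linarith [hρ.out]
  have h0 : MemLp (fun _ : Ω => (0 : ℝ)) (p * ENNReal.ofReal ρ) μ := MemLp.zero
  have h1 : MemLp (fun x => f x (u x) - f x 0) p μ := by
    refine ⟨(hf.aestronglyMeasurable_comp hu.1).sub (hf.aestronglyMeasurable 0),
      (hf.eLpNorm_sub_le hp hu h0).trans_lt ?_⟩
    refine ENNReal.mul_lt_top (ENNReal.mul_lt_top ENNReal.ofReal_lt_top ?_) (hu.sub h0).2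
    refine ENNReal.add_lt_top.2 ⟨ENNReal.add_lt_top.2 ⟨(memLp_const 1).2, ?_⟩, ?_⟩
    · exact ENNReal.rpow_lt_top_of_nonneg he hu.2.ne
    · exact ENNReal.rpow_lt_top_of_nonneg he h0.2.ne
  refine (h1.add (hf.memLp_zero p)).ae_eq (Eventually.of_forall fun x => ?_)
  simp

/-- The Nemytskii operator `u ↦ f(·, u)` from `L^{pρ}(Ω)` to `L^p(Ω)`. -/
noncomputable def nemytskii (hf : IsReaction μ f b C m (ρ - 1)) (hp : p ≠ ⊤)
    (u : Lp ℝ (p * ENNReal.ofReal ρ) μ) : Lp ℝ p μ :=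
  (hf.memLp_comp hp (Lp.memLp u)).toLp

lemma coeFn_nemytskii (hf : IsReaction μ f b C m (ρ - 1)) (hp : p ≠ ⊤)
    (u : Lp ℝ (p * ENNReal.ofReal ρ) μ) : hf.nemytskii hp u =ᵐ[μ] fun x => f x (u x) :=
  MemLp.coeFn_toLp _

/-- The Hölder estimate makes the operator Lipschitz on bounded sets. The drop from `pρ` to `p` is
why the equation is read in `L^p`. -/
lemma continuous_nemytskii (hf : IsReaction μ f b C m (ρ - 1)) (hp : p ≠ ⊤) :
    Continuous (hf.nemytskii hp : Lp ℝ (p * ENNReal.ofReal ρ) μ → Lp ℝ p μ) := by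
  have he : 0 ≤ ρ - 1 := by linarith [hρ.out]
  set D := (eLpNorm (fun _ : Ω => (1 : ℝ)) (p * ENNReal.ofReal ρ / ENNReal.ofReal (ρ - 1)) μ)
  have hD : D ≠ ⊤ := (memLp_const 1).2.ne
  have key : ∀ u v : Lp ℝ (p * ENNReal.ofReal ρ) μ, ‖hf.nemytskii hp u - hf.nemytskii hp v‖ ≤
      C * (D.toReal + ‖u‖ ^ (ρ - 1) + ‖v‖ ^ (ρ - 1)) * ‖u - v‖ := by
    intro u v
    have hu := (Lp.memLp u).2.ne
    have hv := (Lp.memLp v).2.ne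
    have hup := ENNReal.rpow_ne_top_of_nonneg he hu
    have hvp := ENNReal.rpow_ne_top_of_nonneg he hv
    have h1 := hf.eLpNorm_sub_le hp (Lp.memLp u) (Lp.memLp v)
    have h2 : eLpNorm (fun x => u x - v x) (p * ENNReal.ofReal ρ) μ =
        eLpNorm (u - v : Lp ℝ (p * ENNReal.ofReal ρ) μ) (p * ENNReal.ofReal ρ) μ :=
      eLpNorm_congr_ae (Lp.coeFn_sub u v).symm
    have h3 : hf.nemytskii hp u - hf.nemytskii hp v =
        ((hf.memLp_comp hp (Lp.memLp u)).sub (hf.memLp_comp hp (Lp.memLp v))).toLp :=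
      (MemLp.toLp_sub _ _).symm
    rw [h2] at h1
    rw [h3, Lp.norm_toLp]
    refine (ENNReal.toReal_mono ?_ h1).trans_eq ?_
    · exact ENNReal.mul_ne_top (ENNReal.mul_ne_top ENNReal.ofReal_ne_top
        (ENNReal.add_ne_top.2 ⟨ENNReal.add_ne_top.2 ⟨hD, hup⟩, hvp⟩)) (Lp.memLp _).2.ne
    · rw [ENNReal.toReal_mul, ENNReal.toReal_mul, ENNReal.toReal_ofReal hf.C_nonneg,
        ENNReal.toReal_add (ENNReal.add_ne_top.2 ⟨hD, hup⟩) hvp, ENNReal.toReal_add hD hup,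
        ← ENNReal.toReal_rpow, ← ENNReal.toReal_rpow, Lp.norm_def, Lp.norm_def, Lp.norm_def]
  rw [continuous_iff_continuousAt]
  intro v
  rw [ContinuousAt, tendsto_iff_norm_sub_tendsto_zero]
  refine squeeze_zero (fun _ => norm_nonneg _) (fun u => key u v) ?_
  have hc : Continuous fun u : Lp ℝ (p * ENNReal.ofReal ρ) μ =>
      C * (D.toReal + ‖u‖ ^ (ρ - 1) + ‖v‖ ^ (ρ - 1)) * ‖u - v‖ := by
    have : Continuous fun u : Lp ℝ (p * ENNReal.ofReal ρ) μ => ‖u‖ ^ (ρ - 1) :=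
      continuous_norm.rpow_const fun _ => Or.inr he
    fun_prop
  simpa using hc.tendsto v

end IsReaction

/-! ### Variation of constants, limits of solutions, Picard–Lindelöf -/

section Duhamel

variable {E : Type*} [NormedAddCommGroup E] [NormedSpace ℝ E] [CompleteSpace E]

lemma exp_sub_smul (A : E →L[ℝ] E) (t s : ℝ) :
    NormedSpace.exp ((t - s) • A) = NormedSpace.exp (t • A) * NormedSpace.exp ((-s) • A) := by
  rw [sub_eq_add_neg, add_smul]
  exact NormedSpace.exp_add_of_commute_of_mem_ball (𝕂 := ℝ)
    (((Commute.refl A).smul_left t).smul_right (-s))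
    (by simp [NormedSpace.expSeries_radius_eq_top])
    (by simp [NormedSpace.expSeries_radius_eq_top])

lemma continuous_exp_smul (A : E →L[ℝ] E) : Continuous fun t : ℝ => NormedSpace.exp (t • A) :=
  continuous_iff_continuousAt.2 fun t => (hasDerivAt_exp_smul_const A t).continuousAt

/-- The variation of constants formula defines a solution of the inhomogeneous linear equation. -/
lemma hasDerivWithinAt_of_eq_duhamel (A : E →L[ℝ] E) {T : ℝ} {u g : ℝ → E} {u₀ : E}
    (hg : ContinuousOn g (Icc 0 T))
    (hu : ∀ t ∈ Icc 0 T, u t = NormedSpace.exp (t • A) u₀ +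
      ∫ s in (0 : ℝ)..t, NormedSpace.exp ((t - s) • A) (g s)) {t : ℝ} (ht : t ∈ Icc 0 T) :
    HasDerivWithinAt u (A (u t) + g t) (Icc 0 T) t := by
  set G : ℝ → E := fun s => NormedSpace.exp ((-s) • A) (g s) with hG
  have hGc : ContinuousOn G (Icc 0 T) :=
    ((continuous_exp_smul A).comp continuous_neg).continuousOn.clm_apply hg
  have hsub : ∀ s ∈ Icc 0 T, uIcc 0 s ⊆ Icc 0 T := fun s hs => by
    rw [uIcc_of_le hs.1]; exact Icc_subset_Icc_right hs.2
  have hGi : ∀ s ∈ Icc 0 T, IntervalIntegrable G volume 0 s := fun s hs =>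
    (hGc.mono (hsub s hs)).intervalIntegrable
  -- With `e^{sA}` pulled out, `s` enters the integral only through its upper limit, and the product
  -- rule applies.
  have hform : ∀ s ∈ Icc 0 T, u s = NormedSpace.exp (s • A) (u₀ + ∫ r in (0 : ℝ)..s, G r) := by
    intro s hs
    rw [hu s hs, map_add, ← ContinuousLinearMap.intervalIntegral_comp_comm _ (hGi s hs)]
    congr 1
    refine intervalIntegral.integral_congr fun r _ => ?_
    simp only [hG, exp_sub_smul A s r, mul_apply_eq_comp]
  have : Fact (t ∈ Icc 0 T) := ⟨ht⟩
  have hd : HasDerivWithinAt (fun s => ∫ r in (0 : ℝ)..s, G r) (G t) (Icc 0 T) t :=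
    intervalIntegral.integral_hasDerivWithinAt_right (hGi t ht)
      (hGc.stronglyMeasurableAtFilter_nhdsWithin measurableSet_Icc t) (hGc t ht)
  have he : HasDerivWithinAt (fun s : ℝ => NormedSpace.exp (s • A))
      (A * NormedSpace.exp (t • A)) (Icc 0 T) t :=
    (hasDerivAt_exp_smul_const' A t).hasDerivWithinAt
  have h1 := (he.clm_apply (hd.const_add u₀)).congr hform (hform t ht)
  convert h1 using 1
  rw [hform t ht, mul_apply_eq_comp, hG]
  congr 1
  change g t = (NormedSpace.exp (t • A) * NormedSpace.exp ((-t) • A)) (g t)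
  rw [← exp_sub_smul, sub_self, zero_smul, NormedSpace.exp_zero, one_apply_eq_self]

/-- A solution of the inhomogeneous linear equation satisfies the variation of constants formula. -/
lemma eq_duhamel_of_hasDerivWithinAt (A : E →L[ℝ] E) {T : ℝ} {u g : ℝ → E}
    (hg : ContinuousOn g (Icc 0 T))
    (hu : ∀ t ∈ Icc 0 T, HasDerivWithinAt u (A (u t) + g t) (Icc 0 T) t)
    {t : ℝ} (ht : t ∈ Icc 0 T) :
    u t = NormedSpace.exp (t • A) (u 0) +
      ∫ s in (0 : ℝ)..t, NormedSpace.exp ((t - s) • A) (g s) := by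
  have hsub : Icc 0 t ⊆ Icc 0 T := Icc_subset_Icc_right ht.2
  have hexp : Continuous fun s : ℝ => NormedSpace.exp ((t - s) • A) :=
    (continuous_exp_smul A).comp (continuous_const.sub continuous_id)
  -- The integrating factor: the two terms containing `A` cancel, and integration over `[0,t]` gives
  -- the formula.
  have hd : ∀ s ∈ Icc 0 t, HasDerivWithinAt (fun s => NormedSpace.exp ((t - s) • A) (u s))
      (NormedSpace.exp ((t - s) • A) (g s)) (Icc 0 t) s := by
    intro s hs
    have h0 : HasDerivAt (fun s : ℝ => NormedSpace.exp ((t - s) • A))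
        ((-1 : ℝ) • (NormedSpace.exp ((t - s) • A) * A)) s :=
      (hasDerivAt_exp_smul_const A (t - s)).scomp s ((hasDerivAt_id s).const_sub t)
    have h1 := h0.hasDerivWithinAt.clm_apply ((hu s (hsub hs)).mono hsub)
    convert h1 using 1
    simp
  have hint : IntervalIntegrable (fun s => NormedSpace.exp ((t - s) • A) (g s)) volume 0 t := by
    apply ContinuousOn.intervalIntegrable
    rw [uIcc_of_le ht.1]
    exact hexp.continuousOn.clm_apply (hg.mono hsub)
  have key := intervalIntegral.integral_eq_sub_of_hasDeriv_right_of_le ht.1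
    (fun s hs => (hd s hs).continuousWithinAt)
    (fun s hs => ((hd s (Ioo_subset_Icc_self hs)).hasDerivAt
      (Icc_mem_nhds hs.1 hs.2)).hasDerivWithinAt) hint
  rw [key]
  simp

/-- Uniform limits of solutions of `(ι u)' = G(u)` are solutions. -/
lemma exists_limit_solution {F : Type*} [NormedAddCommGroup F] [NormedSpace ℝ F] [CompleteSpace F]
    (ι : E →L[ℝ] F) {G : E → F} (hG : Continuous G) {T : ℝ} (hT : 0 ≤ T) {u : ℕ → ℝ → E}
    (hc : ∀ n, ContinuousOn (u n) (Icc 0 T))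
    (hd : ∀ n, ∀ t ∈ Icc 0 T, HasDerivWithinAt (fun s => ι (u n s)) (G (u n t)) (Icc 0 T) t)
    (hu : UniformCauchySeqOn u atTop (Icc 0 T)) :
    ∃ v : ℝ → E, ContinuousOn v (Icc 0 T) ∧ Tendsto (fun n => u n 0) atTop (𝓝 (v 0)) ∧
      ∀ t ∈ Icc 0 T, HasDerivWithinAt (fun s => ι (v s)) (G (v t)) (Icc 0 T) t := by
  have hlim : ∀ t ∈ Icc 0 T, ∃ y, Tendsto (fun n => u n t) atTop (𝓝 y) := fun t ht =>
    cauchySeq_tendsto_of_complete (hu.cauchySeq ht)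
  choose! v hv using hlim
  have hunif : TendstoUniformlyOn u v atTop (Icc 0 T) := hu.tendstoUniformlyOn_of_tendsto hv
  have hvc : ContinuousOn v (Icc 0 T) := hunif.continuousOn (Frequently.of_forall hc)
  have h0 : (0 : ℝ) ∈ Icc 0 T := ⟨le_rfl, hT⟩
  refine ⟨v, hvc, hv 0 h0, ?_⟩
  -- uniform convergence of the velocities, via the compact-open topology
  let U : ℕ → C(Icc 0 T, E) := fun n => ⟨(Icc 0 T).domRestrict (u n), (hc n).domRestrict⟩
  let V : C(Icc 0 T, E) := ⟨(Icc 0 T).domRestrict v, hvc.domRestrict⟩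
  let GC : C(E, F) := ⟨G, hG⟩
  have hUV : Tendsto U atTop (𝓝 V) := by
    rw [ContinuousMap.tendsto_iff_tendstoUniformly]
    exact tendstoUniformlyOn_iff_tendstoUniformly_comp_coe.1 hunif
  have hGU : Tendsto (fun n => GC.comp (U n)) atTop (𝓝 (GC.comp V)) :=
    ((ContinuousMap.continuous_postcomp GC).tendsto V).comp hUV
  have hGun : TendstoUniformlyOn (fun n s => G (u n s)) (fun s => G (v s)) atTop (Icc 0 T) :=
    tendstoUniformlyOn_iff_tendstoUniformly_comp_coe.2
      (ContinuousMap.tendsto_iff_tendstoUniformly.1 hGU)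
  have hGc : ∀ n, ContinuousOn (fun s => G (u n s)) (Icc 0 T) := fun n =>
    hG.comp_continuousOn (hc n)
  have hGv : ContinuousOn (fun s => G (v s)) (Icc 0 T) := hG.comp_continuousOn hvc
  have hsub : ∀ s ∈ Icc 0 T, Icc 0 s ⊆ Icc 0 T := fun s hs => Icc_subset_Icc_right hs.2
  have hII : ∀ {w : ℝ → F}, ContinuousOn w (Icc 0 T) → ∀ s ∈ Icc 0 T,
      IntervalIntegrable w volume 0 s := fun hw s hs => by
    apply ContinuousOn.intervalIntegrable
    rw [uIcc_of_le hs.1]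
    exact hw.mono (hsub s hs)
  -- The limit is taken in the integrated equation, which is differentiated again at the end.
  have heq : ∀ n, ∀ s ∈ Icc 0 T, ι (u n s) = ι (u n 0) + ∫ r in (0 : ℝ)..s, G (u n r) := by
    intro n s hs
    rw [intervalIntegral.integral_eq_sub_of_hasDeriv_right_of_le (f := fun s => ι (u n s)) hs.1
      (ι.continuous.comp_continuousOn ((hc n).mono (hsub s hs)))
      (fun r hr => (((hd n r (hsub s hs (Ioo_subset_Icc_self hr))).mono (hsub s hs)).hasDerivAt
        (Icc_mem_nhds hr.1 hr.2)).hasDerivWithinAt) (hII (hGc n) s hs)]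
    abel
  have hintlim : ∀ s ∈ Icc 0 T, Tendsto (fun n => ∫ r in (0 : ℝ)..s, G (u n r)) atTop
      (𝓝 (∫ r in (0 : ℝ)..s, G (v r))) := by
    intro s hs
    rw [Metric.tendsto_nhds]
    intro ε hε
    have hpos : 0 < ε / (T + 1) := by positivity
    filter_upwards [Metric.tendstoUniformlyOn_iff.1 hGun _ hpos] with n hn
    rw [dist_eq_norm, ← intervalIntegral.integral_sub (hII (hGc n) s hs) (hII hGv s hs)]
    refine (intervalIntegral.norm_integral_le_of_norm_le_const (C := ε / (T + 1)) ?_).trans_lt ?_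
    · intro r hr
      rw [uIoc_of_le hs.1] at hr
      rw [← dist_eq_norm, dist_comm]
      exact (hn r (hsub s hs (Ioc_subset_Icc_self hr))).le
    · rw [sub_zero, abs_of_nonneg hs.1, div_mul_eq_mul_div, div_lt_iff₀ (by positivity)]
      nlinarith [hs.2]
  have hveq : ∀ s ∈ Icc 0 T, ι (v s) = ι (v 0) + ∫ r in (0 : ℝ)..s, G (v r) := by
    intro s hs
    refine tendsto_nhds_unique ((ι.continuous.tendsto _).comp (hv s hs)) ?_
    refine (((ι.continuous.tendsto _).comp (hv 0 h0)).add (hintlim s hs)).congr fun n => ?_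
    exact (heq n s hs).symm
  intro t ht
  have : Fact (t ∈ Icc 0 T) := ⟨ht⟩
  have hder : HasDerivWithinAt (fun s => ∫ r in (0 : ℝ)..s, G (v r)) (G (v t)) (Icc 0 T) t :=
    intervalIntegral.integral_hasDerivWithinAt_right (hII hGv t ht)
      (hGv.stronglyMeasurableAtFilter_nhdsWithin measurableSet_Icc t) (hGv t ht)
  exact (hder.const_add (ι (v 0))).congr hveq (hveq t ht)

/-- Global solvability for a bounded Lipschitz autonomous vector field. -/
lemma exists_hasDerivWithinAt_of_lipschitz_of_bounded {X : E → E} {K B : ℝ≥0}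
    (hX : LipschitzWith K X) (hB : ∀ x, ‖X x‖ ≤ B) (x₀ : E) {T : ℝ} (hT : 0 ≤ T) :
    ∃ u : ℝ → E, u 0 = x₀ ∧ ∀ t ∈ Icc 0 T, HasDerivWithinAt u (X (u t)) (Icc 0 T) t := by
  -- Speed at most `B` confines the curve to the ball of radius `B T`, so the whole interval is
  -- reached in one step.
  have hPL : IsPicardLindelof (fun _ => X) (tmin := 0) (tmax := T) ⟨0, le_rfl, hT⟩ x₀
      (B * ⟨T, hT⟩) 0 B K :=
    { lipschitzOnWith := fun _ _ => hX.lipschitzOnWith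
      continuousOn := fun _ _ => continuousOn_const
      norm_le := fun _ _ x _ => hB x
      mul_max_le := by
        rw [sub_zero, sub_self, max_eq_left hT, NNReal.coe_zero, sub_zero]
        exact le_rfl }
  exact hPL.exists_eq_forall_mem_Icc_hasDerivWithinAt₀

end Duhamel

/-! ### Bounded initial data: truncation in `L^∞` -/

section Bounded

variable {Ω : Type*} [MeasurableSpace Ω] {μ : Measure Ω} {f : Ω → ℝ → ℝ} {b C m e : ℝ}

lemma ae_abs_le_norm_top (u : Lp ℝ ⊤ μ) : ∀ᵐ x ∂μ, |u x| ≤ ‖u‖ := by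
  rw [Lp.norm_def]; exact ae_abs_le_of_memLp_top (Lp.memLp u)

lemma norm_le_of_ae_abs_le_top [IsFiniteMeasure μ] {u : Lp ℝ ⊤ μ} {c : ℝ} (hc : 0 ≤ c)
    (hu : ∀ᵐ x ∂μ, |u x| ≤ c) : ‖u‖ ≤ c := by
  simpa using Lp.norm_le_of_ae_bound (f := u) hc (by simpa only [Real.norm_eq_abs] using hu)

/-- Truncation of real numbers to `[-k, k]`. -/
def clamp (k s : ℝ) : ℝ := max (-k) (min k s)

lemma lipschitzWith_clamp (k : ℝ) : LipschitzWith 1 (clamp k) :=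
  (LipschitzWith.id.const_min k).const_max (-k)

lemma clamp_zero {k : ℝ} (hk : 0 ≤ k) : clamp k 0 = 0 := by simp [clamp, hk]

lemma abs_clamp_le {k : ℝ} (hk : 0 ≤ k) (s : ℝ) : |clamp k s| ≤ k :=
  abs_le.2 ⟨le_max_left _ _, max_le (by linarith) (min_le_left _ _)⟩

lemma clamp_eq_self {k s : ℝ} (hs : |s| ≤ k) : clamp k s = s := by
  rw [clamp, min_eq_right (abs_le.1 hs).2, max_eq_right (abs_le.1 hs).1]

lemma abs_clamp_sub_le (k s r : ℝ) : |clamp k s - clamp k r| ≤ |s - r| := by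
  simpa [Real.dist_eq] using (lipschitzWith_clamp k).dist_le_mul s r

/-- Truncation preserves one-sided Lipschitz bounds at the origin. -/
lemma mul_clamp_le {k b : ℝ} {φ : ℝ → ℝ} (hk : 0 < k) (hb : 0 ≤ b) (hφ : ∀ s, φ s * s ≤ b * s ^ 2)
    (s : ℝ) : φ (clamp k s) * s ≤ b * s ^ 2 := by
  rcases le_or_gt |s| k with hs | hs
  · rw [clamp_eq_self hs]; exact hφ s
  -- Beyond the cutoff the argument of `φ` is frozen at `±k`. The hypothesis there, divided by `k`,
  -- bounds `±φ (±k)` by `b * k`, which is at most `b * |s|` since `b ≥ 0`.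
  · rcases lt_abs.1 hs with h | h
    · have hc : clamp k s = k := by
        rw [clamp, min_eq_left h.le, max_eq_right (by linarith)]
      have h1 := hφ k
      rw [hc]
      have h2 : φ k ≤ b * k := by nlinarith
      nlinarith [mul_nonneg hb (sub_nonneg.2 h.le)]
    · have hc : clamp k s = -k := by
        rw [clamp, min_eq_right (by linarith), max_eq_left (by linarith)]
      have h1 := hφ (-k)
      rw [hc]
      have h2 : -φ (-k) ≤ b * k := by nlinarith
      nlinarith [mul_nonneg hb (sub_nonneg.2 h.le)]

lemma IsReaction.memLp_clamp [IsFiniteMeasure μ] (hf : IsReaction μ f b C m e) {k : ℝ} (hk : 0 ≤ k)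
    (u : Lp ℝ ⊤ μ) : MemLp (fun x => f x (clamp k (u x))) ⊤ μ := by
  refine MemLp.of_bound (hf.aestronglyMeasurable_comp
    ((lipschitzWith_clamp k).continuous.comp_aestronglyMeasurable (Lp.memLp u).1))
    (m + C * (1 + k ^ e + k ^ e) * k) ?_
  filter_upwards [hf.ae_abs_sub_le_of_abs_le, hf.abs_zero_le] with x h1 h2
  have h3 := h1 k (clamp k (u x)) 0 (abs_clamp_le hk _) (by simpa using hk)
  have h4 : C * (1 + k ^ e + k ^ e) * |clamp k (u x) - 0| ≤ C * (1 + k ^ e + k ^ e) * k := by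
    rw [sub_zero]
    have := hf.C_nonneg
    gcongr
    exact abs_clamp_le hk _
  rw [Real.norm_eq_abs]
  linarith [abs_sub_abs_le_abs_sub (f x (clamp k (u x))) (f x 0)]

/-- The Nemytskii operator of the truncated reaction term, on `L^∞(Ω)`. -/
noncomputable def IsReaction.truncated [IsFiniteMeasure μ] (hf : IsReaction μ f b C m e) {k : ℝ}
    (hk : 0 ≤ k) (u : Lp ℝ ⊤ μ) : Lp ℝ ⊤ μ :=
  (hf.memLp_clamp hk u).toLp

lemma IsReaction.coeFn_truncated [IsFiniteMeasure μ] (hf : IsReaction μ f b C m e) {k : ℝ}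
    (hk : 0 ≤ k) (u : Lp ℝ ⊤ μ) : hf.truncated hk u =ᵐ[μ] fun x => f x (clamp k (u x)) :=
  MemLp.coeFn_toLp _

lemma IsReaction.norm_truncated_sub_le [IsFiniteMeasure μ] (hf : IsReaction μ f b C m e) {k : ℝ}
    (hk : 0 ≤ k) (u v : Lp ℝ ⊤ μ) :
    ‖hf.truncated hk u - hf.truncated hk v‖ ≤ C * (1 + k ^ e + k ^ e) * ‖u - v‖ := by
  refine Lp.norm_le_mul_norm_of_ae_le_mul ?_
  filter_upwards [hf.ae_abs_sub_le_of_abs_le, hf.coeFn_truncated hk u, hf.coeFn_truncated hk v,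
    Lp.coeFn_sub u v, Lp.coeFn_sub (hf.truncated hk u) (hf.truncated hk v)] with x h1 h2 h3 h4 h5
  rw [h5, h4, Pi.sub_apply, Pi.sub_apply, h2, h3, Real.norm_eq_abs, Real.norm_eq_abs]
  refine (h1 k _ _ (abs_clamp_le hk _) (abs_clamp_le hk _)).trans ?_
  have := hf.C_nonneg
  exact mul_le_mul_of_nonneg_left (abs_clamp_sub_le k _ _) (by positivity)

/-- The bound does not depend on `k`; otherwise choosing `k` from the a priori estimate would be
circular. -/
lemma IsReaction.norm_truncated_zero_le [IsFiniteMeasure μ] (hf : IsReaction μ f b C m e) {k : ℝ}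
    (hk : 0 ≤ k) : ‖hf.truncated hk 0‖ ≤ m := by
  refine norm_le_of_ae_abs_le_top hf.m_nonneg ?_
  filter_upwards [hf.coeFn_truncated hk 0, Lp.coeFn_zero ℝ ⊤ μ, hf.abs_zero_le] with x h1 h2 h3
  rw [h1, h2, Pi.zero_apply, clamp_zero hk]
  exact h3

/-- Global existence for bounded initial data, in `L^∞(Ω)`. -/
lemma exists_bounded_solution [IsFiniteMeasure μ] {J : Ω → Ω → ℝ} {h : Ω → ℝ}
    (hJ : KernelMemLp J ⊤ (ENNReal.conjExponent ⊤) μ) (hh : MemLp h ⊤ μ)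
    (hf : IsReaction μ f b C m e) (u₀ : Lp ℝ ⊤ μ) {T : ℝ} (hT : 0 ≤ T) :
    ∃ u u' : ℝ → Lp ℝ ⊤ μ, u 0 = u₀ ∧
      (∀ t ∈ Icc 0 T, HasDerivWithinAt u (u' t) (Icc 0 T) t) ∧
      ∀ t ∈ Icc 0 T, u' t =ᵐ[μ] fun x =>
        (∫ y, J x y * u t y ∂μ) - h x * u t x + f x (u t x) := by
  set c : ℝ := ‖nonlocalK hJ‖ + 1 with hc
  set H : ℝ := (eLpNorm h ⊤ μ).toReal with hH
  have hH0 : 0 ≤ H := ENNReal.toReal_nonneg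
  have hb0 := hf.b_nonneg
  have hm0 := hf.m_nonneg
  have hC0 := hf.C_nonneg
  have hc0 : 0 < c := by positivity
  have hω : 0 < c + (H + b) := by positivity
  -- The a priori bound at time `T`, computed from constants independent of the truncation. The `+
  -- 1` keeps `k` positive for zero data, as the one in `c` keeps the rate positive.
  set k : ℝ := Real.exp ((c + (H + b)) * T) * (‖u₀‖ + m / (c + (H + b)) + 1) with hkdef
  have hk : 0 < k := by positivity
  -- The linear part is truncated too, to make the whole field bounded.
  let P : Lp ℝ ⊤ μ → Lp ℝ ⊤ μ := (lipschitzWith_clamp k).compLp (clamp_zero hk.le)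
  have hPcoe : ∀ u, P u =ᵐ[μ] fun x => clamp k (u x) := fun u => LipschitzWith.coeFn_compLp _ _ u
  have hPlip : ∀ u v, ‖P u - P v‖ ≤ ‖u - v‖ := fun u v => by
    simpa [dist_eq_norm] using
      ((lipschitzWith_clamp k).lipschitzWith_compLp (p := ⊤) (μ := μ)
        (clamp_zero hk.le)).dist_le_mul u v
  have hP0 : P 0 = 0 := LipschitzWith.compLp_zero _ _
  have hPle : ∀ u, ‖P u‖ ≤ ‖u‖ := fun u => by simpa [hP0] using hPlip u 0
  have hPk : ∀ u, ‖P u‖ ≤ k := fun u => by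
    refine norm_le_of_ae_abs_le_top hk.le ?_
    filter_upwards [hPcoe u] with x hx
    rw [hx]; exact abs_clamp_le hk.le _
  set M : ℝ := C * (1 + k ^ e + k ^ e) with hM
  have hM0 : 0 ≤ M := by positivity
  set A := linOp hJ hh with hA
  let X : Lp ℝ ⊤ μ → Lp ℝ ⊤ μ := fun u => A (P u) + hf.truncated hk.le u
  have hX : LipschitzWith (‖A‖₊ + ⟨M, hM0⟩) X := by
    refine LipschitzWith.of_dist_le_mul fun u v => ?_
    rw [dist_eq_norm, dist_eq_norm]
    have h1 : X u - X v = A (P u - P v) + (hf.truncated hk.le u - hf.truncated hk.le v) := by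
      simp only [X, map_sub]; abel
    rw [h1]
    refine (norm_add_le _ _).trans ?_
    have h2 := (A.le_opNorm (P u - P v)).trans
      (mul_le_mul_of_nonneg_left (hPlip u v) (norm_nonneg _))
    have h3 := hf.norm_truncated_sub_le hk.le u v
    have h4 : ((‖A‖₊ + ⟨M, hM0⟩ : ℝ≥0) : ℝ) = ‖A‖ + M := rfl
    rw [h4]
    linarith
  have hB0 : 0 ≤ ‖A‖ * k + (m + M * k) := by positivity
  have hXB : ∀ u, ‖X u‖ ≤ (⟨‖A‖ * k + (m + M * k), hB0⟩ : ℝ≥0) := by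
    intro u
    refine (norm_add_le _ _).trans (add_le_add ?_ ?_)
    · exact (A.le_opNorm _).trans (mul_le_mul_of_nonneg_left (hPk u) (norm_nonneg _))
    · refine norm_le_of_ae_abs_le_top (by positivity) ?_
      filter_upwards [hf.ae_abs_sub_le_of_abs_le, hf.abs_zero_le, hf.coeFn_truncated hk.le u]
        with x h1 h2 h3
      rw [h3]
      have h4 := h1 k (clamp k (u x)) 0 (abs_clamp_le hk.le _) (by simpa using hk.le)
      have h5 : C * (1 + k ^ e + k ^ e) * |clamp k (u x) - 0| ≤ M * k := by
        rw [sub_zero]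
        exact mul_le_mul_of_nonneg_left (abs_clamp_le hk.le _) hM0
      linarith [abs_sub_abs_le_abs_sub (f x (clamp k (u x))) (f x 0)]
  obtain ⟨u, hu0, hu⟩ := exists_hasDerivWithinAt_of_lipschitz_of_bounded hX hXB u₀ hT
  have hbound : ∀ t ∈ Icc 0 T, ‖u t‖ ≤ k := by
    intro t ht
    have key := norm_le_of_velocity_decomposition (c := c) (b := H + b) (ε := m) hω hu ?_ ht
    · have hexp : Real.exp ((c + (H + b)) * t) ≤ Real.exp ((c + (H + b)) * T) :=
        Real.exp_le_exp.2 (mul_le_mul_of_nonneg_left ht.2 hω.le)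
      have hmω : 0 ≤ m / (c + (H + b)) := by positivity
      rw [hu0] at key
      rw [hkdef]
      nlinarith [mul_le_mul_of_nonneg_left hexp (norm_nonneg u₀),
        mul_le_mul_of_nonneg_left hexp hmω, Real.exp_pos ((c + (H + b)) * T)]
    · intro s _
      -- `f(·,0)` is the error term. What remains besides `K` is `φ(clamp u)` with `φ(r) = f(x,r) -
      -- f(x,0) - h r`, to which `mul_clamp_le` applies.
      refine ⟨nonlocalK hJ (P (u s)), (hf.truncated hk.le (u s) - hf.truncated hk.le 0) -
        mulOp hh (P (u s)), hf.truncated hk.le 0, ?_, ?_, hf.norm_truncated_zero_le hk.le, ?_⟩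
      · have h1 : A (P (u s)) = nonlocalK hJ (P (u s)) - mulOp hh (P (u s)) := rfl
        simp only [X, h1]
        abel
      · refine ((nonlocalK hJ).le_opNorm _).trans ?_
        have := hPle (u s)
        rw [hc]
        gcongr
        linarith
      · filter_upwards [hf.mul_sub_le, ae_abs_le_of_memLp_top hh, coeFn_mulOp hh (P (u s)),
          hPcoe (u s), hf.coeFn_truncated hk.le (u s), hf.coeFn_truncated hk.le 0,
          Lp.coeFn_zero ℝ ⊤ μ, Lp.coeFn_sub (hf.truncated hk.le (u s)) (hf.truncated hk.le 0),
          Lp.coeFn_sub (hf.truncated hk.le (u s) - hf.truncated hk.le 0) (mulOp hh (P (u s)))]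
          with x h1 h2 h3 h4 h5 h6 h7 h8 h9
        rw [h9, Pi.sub_apply, h8, Pi.sub_apply, h5, h6, h7, h3, h4, Pi.zero_apply,
          clamp_zero hk.le]
        refine mul_clamp_le (φ := fun r => f x r - f x 0 - h x * r) hk (by positivity)
          (fun r => ?_) (u s x)
        have h10 := h1 r 0
        rw [sub_zero] at h10
        have h11 : -h x ≤ H := (neg_le_abs _).trans h2
        nlinarith [mul_le_mul_of_nonneg_right h11 (sq_nonneg r)]
  refine ⟨u, fun t => X (u t), hu0, hu, fun t ht => ?_⟩
  have hclamp : ∀ᵐ x ∂μ, clamp k (u t x) = u t x := by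
    filter_upwards [ae_abs_le_norm_top (u t)] with x hx
    exact clamp_eq_self (hx.trans (hbound t ht))
  have hPu : P (u t) = u t := Lp.ext ((hPcoe (u t)).trans hclamp)
  have hXu : X (u t) = A (u t) + hf.truncated hk.le (u t) := by simp only [X, hPu]
  filter_upwards [hclamp, coeFn_linOp hJ hh (u t), hf.coeFn_truncated hk.le (u t),
    Lp.coeFn_add (A (u t)) (hf.truncated hk.le (u t))] with x h1 h2 h3 h4
  rw [hXu, h4, Pi.add_apply, h2, h3, h1]

end Bounded

/-! ### Continuous dependence in `L^q` and density of bounded functions -/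

section Stability

variable {Ω : Type*} [MeasurableSpace Ω] {μ : Measure Ω} [IsFiniteMeasure μ] {f : Ω → ℝ → ℝ}
  {b C m e : ℝ} {J : Ω → Ω → ℝ} {h : Ω → ℝ}

/-- Continuous dependence in `L^q(Ω)` on the initial data, for solutions in `L^∞(Ω)`. -/
lemma exists_forall_norm_sub_le_of_bounded_solutions
    (hJ : KernelMemLp J ⊤ (ENNReal.conjExponent ⊤) μ) (hh : MemLp h ⊤ μ)
    (hJ₁ : KernelMemLp J ⊤ 1 μ) (hsymm : ∀ᵐ z ∂(μ.prod μ), J z.1 z.2 = J z.2 z.1)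
    (hf : IsReaction μ f b C m e) {q : ℝ≥0∞} [Fact (1 ≤ q)] (hq : 1 < q) (hq' : q ≠ ⊤) :
    ∃ ω : ℝ, 0 < ω ∧ ∀ (T : ℝ) (u u' v v' : ℝ → Lp ℝ ⊤ μ),
      (∀ t ∈ Icc 0 T, HasDerivWithinAt u (u' t) (Icc 0 T) t) →
      (∀ t ∈ Icc 0 T, u' t =ᵐ[μ] fun x =>
        (∫ y, J x y * u t y ∂μ) - h x * u t x + f x (u t x)) →
      (∀ t ∈ Icc 0 T, HasDerivWithinAt v (v' t) (Icc 0 T) t) →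
      (∀ t ∈ Icc 0 T, v' t =ᵐ[μ] fun x =>
        (∫ y, J x y * v t y ∂μ) - h x * v t x + f x (v t x)) →
      ∀ t ∈ Icc 0 T, ‖(lpIncl le_top (u t) : Lp ℝ q μ) - lpIncl le_top (v t)‖ ≤
        Real.exp (ω * T) * ‖(lpIncl le_top (u 0) : Lp ℝ q μ) - lpIncl le_top (v 0)‖ := by
  obtain ⟨c, hrow, hcol⟩ := hJ₁.exists_lintegral_enorm_le hsymm
  set H : ℝ := (eLpNorm h ⊤ μ).toReal with hH
  have hH0 : 0 ≤ H := ENNReal.toReal_nonneg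
  have hb0 := hf.b_nonneg
  have hω : 0 < ((c : ℝ) + 1) + (H + b) := by positivity
  refine ⟨_, hω, fun T u u' v v' hu hu' hv hv' t ht => ?_⟩
  let ι : Lp ℝ ⊤ μ →L[ℝ] Lp ℝ q μ := lpIncl le_top
  have hK : ∀ d : Lp ℝ ⊤ μ, ‖ι (nonlocalK hJ d)‖ ≤ c * ‖ι d‖ := by
    intro d
    have h1 := eLpNorm_integral_kernel_le hJ₁.1 hrow hcol hq hq' (Lp.memLp d).1
    have h2 : eLpNorm (ι (nonlocalK hJ d)) q μ ≤ c * eLpNorm (ι d) q μ := by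
      rw [coeFn_lpIncl, coeFn_lpIncl, eLpNorm_congr_ae (coeFn_nonlocalK hJ d)]
      exact h1
    rw [Lp.norm_def, Lp.norm_def, ← ENNReal.coe_toReal, ← ENNReal.toReal_mul]
    exact ENNReal.toReal_mono (ENNReal.mul_lt_top ENNReal.coe_lt_top (Lp.memLp (ι d)).2).ne h2
  have hw : ∀ s ∈ Icc 0 T, HasDerivWithinAt (fun s => ι (u s - v s)) (ι (u' s - v' s))
      (Icc 0 T) s := fun s hs =>
    ι.hasFDerivAt.comp_hasDerivWithinAt s ((hu s hs).sub (hv s hs))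
  have key := norm_le_of_velocity_decomposition (c := c + 1) (b := H + b) (ε := 0) hω hw ?_ ht
  · rw [zero_div, zero_mul, add_zero, map_sub, map_sub] at key
    refine key.trans (mul_le_mul_of_nonneg_right ?_ (norm_nonneg _))
    exact Real.exp_le_exp.2 (mul_le_mul_of_nonneg_left ht.2 hω.le)
  · intro s hs
    -- Removing `K` from the difference of velocities leaves `f(u) - f(v) - h (u - v)`, pointwise
    -- dissipative with constant `H + b`.
    refine ⟨ι (nonlocalK hJ (u s - v s)),
      ι ((u' s - nonlocalK hJ (u s)) - (v' s - nonlocalK hJ (v s))), 0, ?_, ?_, by simp, ?_⟩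
    · simp only [map_sub]; abel
    · refine (hK _).trans (mul_le_mul_of_nonneg_right (by linarith) (norm_nonneg _))
    · rw [coeFn_lpIncl, coeFn_lpIncl]
      filter_upwards [hu' s hs, hv' s hs, coeFn_nonlocalK hJ (u s), coeFn_nonlocalK hJ (v s),
        Lp.coeFn_sub (u' s) (nonlocalK hJ (u s)), Lp.coeFn_sub (v' s) (nonlocalK hJ (v s)),
        Lp.coeFn_sub (u' s - nonlocalK hJ (u s)) (v' s - nonlocalK hJ (v s)),
        Lp.coeFn_sub (u s) (v s), hf.mul_sub_le, ae_abs_le_of_memLp_top hh]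
        with x h1 h2 h3 h4 h5 h6 h7 h8 h9 h10
      rw [h7, Pi.sub_apply, h5, h6, h8, Pi.sub_apply, Pi.sub_apply, Pi.sub_apply, h1, h2, h3, h4]
      have h11 := h9 (u s x) (v s x)
      have h12 : -h x ≤ H := (neg_le_abs _).trans h10
      nlinarith [mul_le_mul_of_nonneg_right h12 (sq_nonneg (u s x - v s x))]

/-- Bounded functions are dense in `L^q(Ω)`. -/
lemma denseRange_lpIncl_top {q : ℝ≥0∞} [Fact (1 ≤ q)] (hq' : q ≠ ⊤) :
    DenseRange (lpIncl le_top : Lp ℝ ⊤ μ → Lp ℝ q μ) := by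
  intro u
  rw [Metric.mem_closure_iff]
  intro ε hε
  obtain ⟨g, hg, hgq⟩ := (Lp.memLp u).exists_simpleFunc_eLpNorm_sub_lt hq'
    (ε := ENNReal.ofReal ε) (by simpa using hε)
  have hgt : MemLp g ⊤ μ := SimpleFunc.memLp_top g μ
  refine ⟨_, mem_range_self hgt.toLp, ?_⟩
  rw [dist_eq_norm, Lp.norm_def]
  refine (ENNReal.toReal_lt_of_lt_ofReal (lt_of_le_of_lt (le_of_eq ?_) hg))
  refine eLpNorm_congr_ae ((Lp.coeFn_sub _ _).trans ?_)
  filter_upwards [hgt.coeFn_toLp] with x hx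
  rw [Pi.sub_apply, Pi.sub_apply, coeFn_lpIncl, hx]

end Stability

/-! ### Strong and mild solutions: equivalence, uniqueness, existence -/

section Solutions

variable {Ω : Type*} [MeasurableSpace Ω] {μ : Measure Ω} [IsFiniteMeasure μ]
  {p : ℝ≥0∞} [Fact (1 ≤ p)] {ρ : ℝ} [Fact (1 < ρ)] {f : Ω → ℝ → ℝ}
  {b C m : ℝ} {J : Ω → Ω → ℝ} {h : Ω → ℝ} {T : ℝ} {u v : ℝ → Lp ℝ (p * ENNReal.ofReal ρ) μ}
  {u₀ : Lp ℝ (p * ENNReal.ofReal ρ) μ}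

lemma continuous_incl :
    Continuous (incl : Lp ℝ (p * ENNReal.ofReal ρ) μ → Lp ℝ p μ) :=
  (lpIncl (le_mul_ofReal p ρ)).continuous

/-- The vector field of the evolution equation, from `L^{pρ}(Ω)` to `L^p(Ω)`. -/
noncomputable def vectorField (hJ : KernelMemLp J p p.conjExponent μ) (hh : MemLp h ⊤ μ)
    (hf : IsReaction μ f b C m (ρ - 1)) (hp : p ≠ ⊤) (v : Lp ℝ (p * ENNReal.ofReal ρ) μ) :
    Lp ℝ p μ :=
  linOp hJ hh (incl v) + hf.nemytskii hp v

lemma coeFn_vectorField (hJ : KernelMemLp J p p.conjExponent μ) (hh : MemLp h ⊤ μ)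
    (hf : IsReaction μ f b C m (ρ - 1)) (hp : p ≠ ⊤) (v : Lp ℝ (p * ENNReal.ofReal ρ) μ) :
    vectorField hJ hh hf hp v =ᵐ[μ] fun x =>
      (∫ y, J x y * v y ∂μ) - h x * v x + f x (v x) := by
  filter_upwards [Lp.coeFn_add (linOp hJ hh (incl v)) (hf.nemytskii hp v),
    coeFn_linOp hJ hh (incl v), hf.coeFn_nemytskii hp v] with x h1 h2 h3
  rw [vectorField, h1, Pi.add_apply, h2, h3, coeFn_incl]

lemma continuous_vectorField (hJ : KernelMemLp J p p.conjExponent μ) (hh : MemLp h ⊤ μ)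
    (hf : IsReaction μ f b C m (ρ - 1)) (hp : p ≠ ⊤) : Continuous (vectorField hJ hh hf hp) :=
  ((linOp hJ hh).continuous.comp continuous_incl).add (hf.continuous_nemytskii hp)

/-- The equation determines `u'` as an `L^p` class, and continuity of the vector field makes the
`C¹` condition automatic. -/
lemma isStrongSolution_iff (hJ : KernelMemLp J p p.conjExponent μ) (hh : MemLp h ⊤ μ)
    (hf : IsReaction μ f b C m (ρ - 1)) (hp : p ≠ ⊤) :
    IsStrongSolution J h f u₀ T u ↔ ContinuousOn u (Icc 0 T) ∧ u 0 = u₀ ∧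
      ∀ t ∈ Icc 0 T, HasDerivWithinAt (fun s => (incl (u s) : Lp ℝ p μ))
        (vectorField hJ hh hf hp (u t)) (Icc 0 T) t := by
  constructor
  · rintro ⟨hc, h0, u', -, hd, heq⟩
    refine ⟨hc, h0, fun t ht => ?_⟩
    have : vectorField hJ hh hf hp (u t) = u' t :=
      Lp.ext ((coeFn_vectorField hJ hh hf hp (u t)).trans (heq t ht).symm)
    rw [this]
    exact hd t ht
  · rintro ⟨hc, h0, hd⟩
    exact ⟨hc, h0, fun t => vectorField hJ hh hf hp (u t),
      (continuous_vectorField hJ hh hf hp).comp_continuousOn hc, hd,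
      fun t _ => coeFn_vectorField hJ hh hf hp (u t)⟩

lemma IsStrongSolution.mono {S : ℝ} (hu : IsStrongSolution J h f u₀ T u) (hST : S ≤ T) :
    IsStrongSolution J h f u₀ S u := by
  obtain ⟨hc, h0, u', hc', hd, heq⟩ := hu
  have hsub : Icc 0 S ⊆ Icc 0 T := Icc_subset_Icc_right hST
  exact ⟨hc.mono hsub, h0, u', hc'.mono hsub, fun t ht => (hd t (hsub ht)).mono hsub,
    fun t ht => heq t (hsub ht)⟩

lemma IsStrongSolution.congr (hT : 0 ≤ T) (hu : IsStrongSolution J h f u₀ T u)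
    (huv : EqOn v u (Icc 0 T)) : IsStrongSolution J h f u₀ T v := by
  obtain ⟨hc, h0, u', hc', hd, heq⟩ := hu
  refine ⟨hc.congr huv, (huv ⟨le_rfl, hT⟩).trans h0, u', hc', fun t ht => ?_, fun t ht => ?_⟩
  · exact (hd t ht).congr (fun s hs => by rw [huv hs]) (by rw [huv ht])
  · rw [huv ht]; exact heq t ht

/-- The forcing `g` is only assumed integrable, but it equals the Nemytskii operator along a
continuous curve. It is thus continuous, and Duhamel's formula can be differentiated. -/
lemma IsMildSolution.isStrongSolution (hJ : KernelMemLp J p p.conjExponent μ) (hh : MemLp h ⊤ μ)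
    (hf : IsReaction μ f b C m (ρ - 1)) (hp : p ≠ ⊤) (hT : 0 ≤ T)
    (hu : IsMildSolution hJ hh f u₀ T u) : IsStrongSolution J h f u₀ T u := by
  obtain ⟨hc, g, -, hg, heq⟩ := hu
  have hgN : EqOn g (fun t => hf.nemytskii hp (u t)) (Icc 0 T) := fun t ht =>
    Lp.ext ((hg t ht).trans (hf.coeFn_nemytskii hp (u t)).symm)
  have hgc : ContinuousOn g (Icc 0 T) :=
    ((hf.continuous_nemytskii hp).comp_continuousOn hc).congr hgN
  refine (isStrongSolution_iff hJ hh hf hp).2 ⟨hc, ?_, fun t ht => ?_⟩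
  · apply lpIncl_injective (le_mul_ofReal p ρ)
    have := heq 0 ⟨le_rfl, hT⟩
    rwa [zero_smul, NormedSpace.exp_zero, one_apply_eq_self, intervalIntegral.integral_same,
      add_zero] at this
  · have := hasDerivWithinAt_of_eq_duhamel (linOp hJ hh) hgc heq ht
    rwa [hgN ht] at this

lemma IsStrongSolution.isMildSolution (hJ : KernelMemLp J p p.conjExponent μ) (hh : MemLp h ⊤ μ)
    (hf : IsReaction μ f b C m (ρ - 1)) (hp : p ≠ ⊤)
    (hu : IsStrongSolution J h f u₀ T u) : IsMildSolution hJ hh f u₀ T u := by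
  obtain ⟨hc, h0, hd⟩ := (isStrongSolution_iff hJ hh hf hp).1 hu
  have hgc : ContinuousOn (fun t => hf.nemytskii hp (u t)) (Icc 0 T) :=
    (hf.continuous_nemytskii hp).comp_continuousOn hc
  refine ⟨hc, fun t => hf.nemytskii hp (u t), hgc.integrableOn_Icc,
    fun t _ => hf.coeFn_nemytskii hp (u t), fun t ht => ?_⟩
  rw [← h0]
  exact eq_duhamel_of_hasDerivWithinAt (linOp hJ hh) hgc hd ht

/-- Uniqueness of strong solutions. -/
lemma IsStrongSolution.eqOn (hJ : KernelMemLp J p p.conjExponent μ) (hh : MemLp h ⊤ μ)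
    (hf : IsReaction μ f b C m (ρ - 1)) (hp : p ≠ ⊤)
    (hu : IsStrongSolution J h f u₀ T u) (hv : IsStrongSolution J h f u₀ T v) :
    EqOn u v (Icc 0 T) := by
  obtain ⟨-, hu0, hud⟩ := (isStrongSolution_iff hJ hh hf hp).1 hu
  obtain ⟨-, hv0, hvd⟩ := (isStrongSolution_iff hJ hh hf hp).1 hv
  intro t ht
  set H : ℝ := (eLpNorm h ⊤ μ).toReal with hH
  have hH0 : 0 ≤ H := ENNReal.toReal_nonneg
  have hb0 := hf.b_nonneg
  have hω : 0 < (‖nonlocalK hJ‖ + 1) + (H + b) := by positivity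
  -- The argument is run in `L^p`, the space in which `u` is differentiable; injectivity of the
  -- inclusion brings equality back to `L^{pρ}`.
  have key := norm_le_of_velocity_decomposition (c := ‖nonlocalK hJ‖ + 1) (b := H + b) (ε := 0) hω
    (w := fun s => incl (u s) - incl (v s)) (fun s hs => (hud s hs).sub (hvd s hs)) ?_ ht
  · rw [hu0, hv0, sub_self, norm_zero, mul_zero, zero_div, zero_mul, add_zero] at key
    exact lpIncl_injective (le_mul_ofReal p ρ) (sub_eq_zero.1 (norm_le_zero_iff.1 key))
  · intro s _
    refine ⟨nonlocalK hJ (incl (u s) - incl (v s)),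
      (hf.nemytskii hp (u s) - hf.nemytskii hp (v s)) - mulOp hh (incl (u s) - incl (v s)), 0,
      ?_, ?_, by simp, ?_⟩
    · have h1 : ∀ w : Lp ℝ p μ, linOp hJ hh w = nonlocalK hJ w - mulOp hh w := fun _ => rfl
      simp only [vectorField, h1, map_sub]
      abel
    · exact ((nonlocalK hJ).le_opNorm _).trans
        (mul_le_mul_of_nonneg_right (by linarith) (norm_nonneg _))
    · filter_upwards [hf.coeFn_nemytskii hp (u s), hf.coeFn_nemytskii hp (v s),
        coeFn_mulOp hh (incl (u s) - incl (v s)),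
        Lp.coeFn_sub (incl (u s) : Lp ℝ p μ) (incl (v s)),
        Lp.coeFn_sub (hf.nemytskii hp (u s)) (hf.nemytskii hp (v s)),
        Lp.coeFn_sub (hf.nemytskii hp (u s) - hf.nemytskii hp (v s))
          (mulOp hh (incl (u s) - incl (v s))), hf.mul_sub_le, ae_abs_le_of_memLp_top hh]
        with x h1 h2 h3 h4 h5 h6 h7 h8
      rw [h6, Pi.sub_apply, h5, Pi.sub_apply, h3, h1, h2, h4, Pi.sub_apply, coeFn_incl, coeFn_incl]
      have h9 := h7 (u s x) (v s x)
      have h10 : -h x ≤ H := (neg_le_abs _).trans h8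
      nlinarith [mul_le_mul_of_nonneg_right h10 (sq_nonneg (u s x - v s x))]

/-- Existence of strong solutions on bounded time intervals. -/
lemma exists_isStrongSolution (hJ : KernelMemLp J p p.conjExponent μ) (hJ₁ : KernelMemLp J ⊤ 1 μ)
    (hsymm : ∀ᵐ z ∂(μ.prod μ), J z.1 z.2 = J z.2 z.1) (hh : MemLp h ⊤ μ)
    (hf : IsReaction μ f b C m (ρ - 1)) (hp : p ≠ ⊤)
    (u₀ : Lp ℝ (p * ENNReal.ofReal ρ) μ) (hT : 0 ≤ T) :
    ∃ u, IsStrongSolution J h f u₀ T u := by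
  have hp1 : 1 ≤ p := Fact.out
  have hρ1 : 1 < ρ := Fact.out
  have hq' : p * ENNReal.ofReal ρ ≠ ⊤ := ENNReal.mul_ne_top hp ENNReal.ofReal_ne_top
  have hq : 1 < p * ENNReal.ofReal ρ := by
    have h1 : 1 < ENNReal.ofReal ρ := by simpa using hρ1
    exact h1.trans_le (le_mul_of_one_le_left zero_le hp1)
  have hJt : KernelMemLp J ⊤ (ENNReal.conjExponent ⊤) μ := by
    simpa [ENNReal.conjExponent] using hJ₁
  let ι : Lp ℝ ⊤ μ →L[ℝ] Lp ℝ (p * ENNReal.ofReal ρ) μ := lpIncl le_top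
  let κ : Lp ℝ (p * ENNReal.ofReal ρ) μ →L[ℝ] Lp ℝ p μ := lpIncl (le_mul_ofReal p ρ)
  obtain ⟨ω, hω, hstab⟩ :=
    exists_forall_norm_sub_le_of_bounded_solutions hJt hh hJ₁ hsymm hf hq hq'
  obtain ⟨y, hy, hyu⟩ := mem_closure_iff_seq_limit.1 (denseRange_lpIncl_top (μ := μ) hq' u₀)
  choose a ha using hy
  choose w w' hw0 hwd hweq using fun n => exists_bounded_solution hJt hh hf (a n) hT
  have hcau : UniformCauchySeqOn (fun n s => ι (w n s)) atTop (Icc 0 T) := by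
    rw [Metric.uniformCauchySeqOn_iff]
    intro ε hε
    obtain ⟨N, hN⟩ := Metric.cauchySeq_iff.1 hyu.cauchySeq (ε / Real.exp (ω * T)) (by positivity)
    refine ⟨N, fun i hi j hj t ht => ?_⟩
    have h1 := hstab T (w i) (w' i) (w j) (w' j) (hwd i) (hweq i) (hwd j) (hweq j) t ht
    have h2 := hN i hi j hj
    rw [dist_eq_norm, ← ha, ← ha, ← hw0 i, ← hw0 j, lt_div_iff₀ (Real.exp_pos _)] at h2
    rw [dist_eq_norm]
    exact h1.trans_lt (by rwa [mul_comm])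
  obtain ⟨u, huc, hu0, hud⟩ := exists_limit_solution κ (continuous_vectorField hJ hh hf hp) hT
    (u := fun n s => ι (w n s))
    (fun n s hs => ι.continuous.continuousAt.comp_continuousWithinAt
      (hwd n s hs).continuousWithinAt)
    -- The approximations are differentiable in `L^∞`, and the derivative is carried to `L^p` by the
    -- continuous inclusions.
    (fun n t ht => by
      have h1 : vectorField hJ hh hf hp (ι (w n t)) = κ (ι (w' n t)) :=
        Lp.ext ((coeFn_vectorField hJ hh hf hp _).trans (hweq n t ht).symm)
      rw [h1]
      exact (κ.comp ι).hasFDerivAt.comp_hasDerivWithinAt t (hwd n t ht)) hcau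
  refine ⟨u, (isStrongSolution_iff hJ hh hf hp).2 ⟨huc, tendsto_nhds_unique hu0 ?_, hud⟩⟩
  refine hyu.congr fun n => ?_
  rw [← ha, ← hw0 n]

end Solutions

end NonlocalDiffusion

/-! ### The global solution -/

theorem theorem3p10 {Ω : Type*} [MeasurableSpace Ω] (μ : Measure Ω) [IsFiniteMeasure μ]
    (p : ℝ≥0∞) [Fact (1 ≤ p)] (hp : p ≠ ⊤) (ρ : ℝ) [Fact (1 < ρ)]
    -- the kernel: symmetric, nonnegative, in `L^∞(L^1) ∩ L^p(L^{p'})`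
    (J : Ω → Ω → ℝ)
    (hJsymm : ∀ᵐ z ∂(μ.prod μ), J z.1 z.2 = J z.2 z.1)
    (hJnonneg : ∀ᵐ z ∂(μ.prod μ), 0 ≤ J z.1 z.2)
    (hJ₁ : KernelMemLp J ⊤ 1 μ)
    (hJ : KernelMemLp J p p.conjExponent μ)
    (h : Ω → ℝ) (hh : MemLp h ⊤ μ)
    -- the reaction term: measurable in `x`, locally Lipschitz in `s` uniformly in `x`
    (f : Ω → ℝ → ℝ)
    (hfmeas : ∀ s : ℝ, AEStronglyMeasurable (fun x => f x s) μ)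
    (hfLip : ∀ R : ℝ, ∃ M : ℝ≥0, ∀ᵐ x ∂μ, LipschitzOnWith M (f x) (Icc (-R) R))
    (hf0 : MemLp (fun x => f x 0) ⊤ μ)
    (β : Ω → ℝ) (hβ : MemLp β ⊤ μ)
    (hfβ : ∀ᵐ x ∂μ, ∀ᵐ s : ℝ, deriv (f x) s ≤ β x)
    (C : ℝ)
    (hfC : ∀ᵐ x ∂μ, ∀ᵐ s : ℝ, |deriv (f x) s| ≤ C * (1 + |s| ^ (ρ - 1)))
    (u₀ : Lp ℝ (p * ENNReal.ofReal ρ) μ) :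
    ∃ u : ℝ → Lp ℝ (p * ENNReal.ofReal ρ) μ,
      (∀ T : ℝ, 0 < T → IsMildSolution hJ hh f u₀ T u ∧ IsStrongSolution J h f u₀ T u) ∧
      -- uniqueness, on every time interval
      ∀ T : ℝ, 0 < T → ∀ v : ℝ → Lp ℝ (p * ENNReal.ofReal ρ) μ,
        (IsMildSolution hJ hh f u₀ T v ∨ IsStrongSolution J h f u₀ T v) →
          EqOn v u (Icc 0 T) := by

  have hf := isReaction_of_ae_deriv Fact.out hfmeas hfLip hf0 hβ hfβ hfC
  choose! S hS using fun (T : ℝ) (hT : 0 ≤ T) =>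
    exists_isStrongSolution hJ hJ₁ hJsymm hh hf hp u₀ hT
  -- The value at `t` is taken from the solution on `[0, t+1]`, one horizon beyond `t`. By
  -- uniqueness it agrees with the solution on `[0,T]` for every `T ≥ t`.
  have hstrong : ∀ T : ℝ, 0 < T → IsStrongSolution J h f u₀ T fun t => S (t + 1) t := by
    intro T hT
    refine (hS T hT.le).congr hT.le fun t ht => ?_
    have ht1 : 0 ≤ t + 1 := by linarith [ht.1]
    exact ((hS (t + 1) ht1).mono (min_le_right T (t + 1))).eqOn hJ hh hf hp
      ((hS T hT.le).mono (min_le_left T (t + 1))) ⟨ht.1, le_min ht.2 (by linarith)⟩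
  refine ⟨fun t => S (t + 1) t,
    fun T hT => ⟨(hstrong T hT).isMildSolution hJ hh hf hp, hstrong T hT⟩, ?_⟩
  rintro T hT v (hv | hv)
  · exact (hv.isStrongSolution hJ hh hf hp hT.le).eqOn hJ hh hf hp (hstrong T hT)
  · exact hv.eqOn hJ hh hf hp (hstrong T hT)
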